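/- Let $k\ge 3$ and let $\widetilde V\subset\mathbb C^k$ be an algebraic variety (the common zero set of a family of polynomials, not necessarily irreducible) of codimension $2$. Then there is a Short $\mathbb C^k$ $\Omega\subset\mathbb C^k$ with $\Omega\cap\widetilde V=\emptyset$. Here a Short $\mathbb C^k$ is a non-empty connected open set $\Omega\subset\mathbb C^k$ such that (a) $\Omega=\bigcup_{j}\Omega_j$ for open sets $\Omega_j\subset\Omega_{j+1}$, each biholomorphic to the Euclidean unit ball of $\mathbb C^k$; (b) the infinitesimal Kobayashi metric of $\Omega$ vanishes identically; (c) there is a plurisubharmonic function $\phi:\mathbb C^k\to\mathbb R$, bounded below and non-constant on $\Omega$, with $\Omega=\{z\in\mathbb C^k:\phi(z)<0\}$. More precisely, let $d\ge2$ be an integer, $0<a<1$, let $\eta_n\in\mathbb C\setminus\{0\}$ with $|\eta_n|\le a^{d^n}$ for all $n\ge0$, and put $$F_n(z_1,\dots,z_k)=(\eta_nz_k,\;z_2^d+\eta_nz_1,\;z_3^d+\eta_nz_2,\;\dots,\;z_k^d+\eta_nz_{k-1}),$$ $$\Omega_{\{F_n\}}=\{z\in\mathbb C^k: F_n\circ\cdots\circ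 F_0(z)\to0\ \text{as}\ n\to\infty\}.$$ For $R>1+a$ let $V^+=\{z\in\mathbb C^k:\|z\|_\infty=|z_i|\ge R\text{ for some }2\le i\le k\}$ and $\mathcal A_R(z)=z+(0,2R,0,\dots,0)$. Then there is an invertible complex linear map $L$ of $\mathbb C^k$ such that $\mathcal A_R\circ L(\widetilde V)\subset V^+$, the set $L^{-1}\circ\mathcal A_R^{-1}(\Omega_{\{F_n\}})$ is a Short $\mathbb C^k$, and it does not intersect $\widetilde V$. -/

import Mathlib

open scoped NNReal ENNReal Topology

noncomputable section

namespace ShortCk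

/-! `ℂ^k` is `Fin k → ℂ`; its Mathlib norm is the sup norm `‖z‖_∞`.  The coordinates
`z_1, …, z_k` have the indices `0, …, k - 1`. -/

/-- The Euclidean unit ball of `ℂ^k`. -/
def unitBall (k : ℕ) : Set (Fin k → ℂ) :=
  {z | ∑ i, ‖z i‖ ^ 2 < 1}

/-- `U` and `W` (meant to be open) are biholomorphic. -/
def Biholomorphic {k : ℕ} (U W : Set (Fin k → ℂ)) : Prop :=
  ∃ f g : (Fin k → ℂ) → (Fin k → ℂ),
    DifferentiableOn ℂ f U ∧ DifferentiableOn ℂ g W ∧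
    Set.MapsTo f U W ∧ Set.MapsTo g W U ∧ Set.InvOn g f U W

/-- The infinitesimal Kobayashi (pseudo)metric of `Ω` at the point `p` in the direction `ξ`: the
infimum of the `α > 0` such that `α f'(0) = ξ` for some holomorphic `f` from the unit disc
to `Ω` with `f(0) = p`. -/
def kobayashiMetric {k : ℕ} (Ω : Set (Fin k → ℂ)) (p ξ : Fin k → ℂ) : ℝ≥0∞ :=
  ⨅ (α : ℝ≥0) (_ : 0 < α ∧ ∃ f : ℂ → (Fin k → ℂ),
      DifferentiableOn ℂ f (Metric.ball 0 1) ∧ Set.MapsTo f (Metric.ball 0 1) Ω ∧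
      f 0 = p ∧ ((α : ℝ) : ℂ) • deriv f 0 = ξ), (α : ℝ≥0∞)

/-- A real-valued (so nowhere `-∞`) function on `ℂ^k` is plurisubharmonic: it is upper
semicontinuous and satisfies the sub-mean value inequality on every circle of every complex line.
Upper semicontinuity bounds `φ` above on the circle, so the integrability clause says that the
mean value is not `-∞`, which the inequality for a finite `φ z` entails. -/
def IsPlurisubharmonic {k : ℕ} (φ : (Fin k → ℂ) → ℝ) : Prop :=
  UpperSemicontinuous φ ∧
  ∀ z w : Fin k → ℂ,
    CircleIntegrable (fun ζ : ℂ => φ (z + ζ • w)) 0 1 ∧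
    φ z ≤ Real.circleAverage (fun ζ : ℂ => φ (z + ζ • w)) 0 1

/-- A Short `ℂ^k`. -/
structure IsShortCk {k : ℕ} (Ω : Set (Fin k → ℂ)) : Prop where
  isOpen : IsOpen Ω
  /-- This includes that `Ω` is non-empty. -/
  isConnected : IsConnected Ω
  exhaustion : ∃ U : ℕ → Set (Fin k → ℂ),
    (∀ j, IsOpen (U j) ∧ U j ⊆ U (j + 1) ∧ Biholomorphic (U j) (unitBall k)) ∧
    Ω = ⋃ j, U j
  kobayashi_eq_zero : ∀ p ∈ Ω, ∀ ξ : Fin k → ℂ, kobayashiMetric Ω p ξ = 0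
  exists_psh : ∃ φ : (Fin k → ℂ) → ℝ,
    IsPlurisubharmonic φ ∧ BddBelow (Set.range φ) ∧ Ω = {z | φ z < 0} ∧
    ∃ p ∈ Ω, ∃ q ∈ Ω, φ p ≠ φ q

/-- `V ⊆ ℂ^k` is an affine algebraic variety (not necessarily irreducible) of codimension `c`;
the height of its ideal is the smallest codimension of a component, that is `k - dim V`. -/
def IsAlgebraicOfCodim {k : ℕ} (V : Set (Fin k → ℂ)) (c : ℕ) : Prop :=
  (∃ I : Ideal (MvPolynomial (Fin k) ℂ), V = MvPolynomial.zeroLocus ℂ I) ∧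
  (MvPolynomial.vanishingIdeal ℂ V).height = c

/-- `F(n) = F_n ∘ ⋯ ∘ F_0`. -/
def iterSeq {X : Type*} (F : ℕ → X → X) : ℕ → X → X
  | 0 => F 0
  | n + 1 => F (n + 1) ∘ iterSeq F n

/-- The non-autonomous basin of attraction of `(F_n)` at the origin. -/
def basin {k : ℕ} (F : ℕ → (Fin k → ℂ) → (Fin k → ℂ)) : Set (Fin k → ℂ) :=
  {z | Filter.Tendsto (fun n => iterSeq F n z) Filter.atTop (𝓝 0)}

/-- The map
`(z_1, …, z_k) ↦ (η z_k, z_2 ^ d + η z_1, z_3 ^ d + η z_2, …, z_k ^ d + η z_{k-1})`;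
`(finRotate k).symm` is the cyclic predecessor on the indices. -/
def shiftMap (k d : ℕ) (η : ℂ) (z : Fin k → ℂ) : Fin k → ℂ :=
  fun i => (if i.val = 0 then 0 else z i ^ d) + η * z ((finRotate k).symm i)

/-- `V⁺ = {z | ‖z‖_∞ = |z_i| ≥ R for some 2 ≤ i ≤ k}`. -/
def Vplus (k : ℕ) (R : ℝ) : Set (Fin k → ℂ) :=
  {z | ∃ i : Fin k, i.val ≠ 0 ∧ ‖z‖ = ‖z i‖ ∧ R ≤ ‖z i‖}

/-- The translation `z ↦ z + (0, 2R, 0, …, 0)`. -/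
def translate (k : ℕ) (R : ℝ) (z : Fin k → ℂ) : Fin k → ℂ :=
  fun i => z i + (if i.val = 1 then ((2 * R : ℝ) : ℂ) else 0)

end ShortCk

end

open scoped NNReal ENNReal Topology

noncomputable section

namespace ShortCk

/-! ### Linear projections of varieties of codimension two -/

section Height

open Polynomial

-- The proof joins a dynamical fact, that the basin misses `Vplus`, to an algebraic one, that an
-- affine map moves `V` into `Vplus`.
--
-- Dynamics: on `Vplus` the power `z_i ^ d` beats the perturbation `η z`, so `Vplus` is forward
-- invariant and orbits in it keep norm at least `R` (`disjoint_basin_Vplus`). Late maps contract a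
-- fixed ball, so the basin is the increasing union of preimages of that ball under automorphisms.
-- Derivatives along an orbit in the basin tend to `0`, so pulling back affine discs kills the
-- Kobayashi metric. The defining function is `log a` plus the decreasing limit of `greenSeq`, which
-- is zero at the origin and positive somewhere in the basin.
--
-- Algebra: after a linear change of coordinates, one non-zero polynomial vanishing on `V` bounds
-- the first coordinate linearly by the others (`exists_linearEquiv_norm_zero_le`). Height two
-- leaves a non-zero vanishing polynomial free of the first variable
-- (`exists_ne_zero_eval_tail_eq_zero`), which bounds the second coordinate by the remaining ones.
-- Scaling makes both constants `1 / 2` (`exists_linearEquiv_norm_le`). Far out, `V` is then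
-- dominated by coordinates beyond the second; the translation by `2R` pushes the rest of `V` into
-- `Vplus`.

attribute [local instance] Polynomial.algebra Polynomial.isLocalization in
/-- A prime of `A[X]` that contracts to zero has height at most one. -/
theorem height_le_one_of_comap_C_eq_bot {A : Type*} [CommRing A] [IsDomain A]
    (P : Ideal A[X]) [P.IsPrime] (hP : P.comap (C : A →+* A[X]) = ⊥) : P.height ≤ 1 := by
  -- Inverting the non-zero constants preserves the height of `P`, and `K[X]` has dimension at most
  -- one.
  let K := FractionRing A
  have disj : Disjoint ((nonZeroDivisors A).map (C : A →+* A[X]) : Set A[X]) P := by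
    refine Set.disjoint_left.mpr ?_
    rintro _ ⟨b, hb, rfl⟩ ha
    have : b ∈ P.comap (C : A →+* A[X]) := ha
    rw [hP, Ideal.mem_bot] at this
    exact nonZeroDivisors.ne_zero hb this
  have hprime : (P.map (algebraMap A[X] K[X])).IsPrime :=
    IsLocalization.isPrime_of_isPrime_disjoint ((nonZeroDivisors A).map (C : A →+* A[X])) K[X] P
      inferInstance disj
  rw [← IsLocalization.height_map_of_disjoint (S := K[X])
    ((nonZeroDivisors A).map (C : A →+* A[X])) P disj]
  have h1 : ringKrullDim K[X] ≤ 1 := (Ring.krullDimLE_iff (n := 1)).mp inferInstance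
  exact_mod_cast (Ideal.height_le_ringKrullDim_of_isPrime (I := P.map (algebraMap A[X] K[X]))).trans
    h1

/-- A radical ideal is the intersection of its finitely many minimal primes. Were its contraction
zero, then, `⊥` being prime in a domain, one minimal prime would contract to zero and have height at
most one. -/
theorem comap_C_ne_bot_of_two_le_height {A : Type*} [CommRing A] [IsDomain A] [IsNoetherianRing A]
    (I : Ideal A[X]) (hr : I.IsRadical) (hI : 2 ≤ I.height) :
    I.comap (C : A →+* A[X]) ≠ ⊥ := by
  intro h0
  have hfin := I.finite_minimalPrimes_of_isNoetherianRing
  have h1 : (hfin.toFinset.inf fun P => P.comap (C : A →+* A[X])) ≤ ⊥ := by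
    intro x hx
    simp only [Submodule.mem_finsetInf, Set.Finite.mem_toFinset, Ideal.mem_comap] at hx
    have : C x ∈ sInf I.minimalPrimes := Submodule.mem_sInf.mpr hx
    rwa [Ideal.sInf_minimalPrimes, hr.radical, ← Ideal.mem_comap, h0] at this
  obtain ⟨P, hP, hPb⟩ := (Ideal.IsPrime.inf_le' (Ideal.isPrime_bot (α := A))).mp h1
  rw [Set.Finite.mem_toFinset] at hP
  have := hP.isPrime
  have h2 := height_le_one_of_comap_C_eq_bot P (le_bot_iff.mp hPb)
  have h3 := (hI.trans (Ideal.height_mono hP.le)).trans h2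
  exact absurd h3 (by norm_num)

end Height

/-! ### Growth of algebraic sets in linear coordinates -/

section Growth

open MvPolynomial

theorem eval_smul_of_isHomogeneous {σ : Type*} [Fintype σ] {p : MvPolynomial σ ℂ} {n : ℕ}
    (hp : p.IsHomogeneous n) (t : ℂ) (x : σ → ℂ) : eval (t • x) p = t ^ n * eval x p := by
  rw [eval_eq', eval_eq', Finset.mul_sum]
  refine Finset.sum_congr rfl fun s hs => ?_
  have hd : ∑ i, s i = n := by
    have := hp (mem_support_iff.mp hs)
    change Finsupp.weight (fun _ => 1) s = n at this
    rwa [← Finsupp.degree_eq_weight_one, Finsupp.degree_eq_sum] at this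
  simp only [Pi.smul_apply, smul_eq_mul, mul_pow, Finset.prod_mul_distrib,
    Finset.prod_pow_eq_pow_sum, hd]
  ring

theorem homogeneousComponent_totalDegree_ne_zero {σ : Type*} {p : MvPolynomial σ ℂ} (hp : p ≠ 0) :
    homogeneousComponent p.totalDegree p ≠ 0 := by
  obtain ⟨s, hs, hd⟩ := Finset.exists_mem_eq_sup p.support (support_nonempty.mpr hp)
    (fun s => s.sum fun _ e => e)
  intro h
  have := congrArg (coeff s) h
  rw [coeff_homogeneousComponent, if_pos, coeff_zero] at this
  · exact mem_support_iff.mp hs this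
  · rw [MvPolynomial.totalDegree, hd]; rfl

/-- After a linear change of coordinates, the first coordinate grows at most linearly in the others
on the zero set of a non-zero polynomial. -/
theorem exists_linearEquiv_norm_zero_le {n : ℕ} {p : MvPolynomial (Fin (n + 1)) ℂ} (hp : p ≠ 0) :
    ∃ (L : (Fin (n + 1) → ℂ) ≃L[ℂ] (Fin (n + 1) → ℂ)) (c : ℝ), 0 < c ∧
      ∀ z, eval z p = 0 → ‖L z 0‖ ≤ c * (1 + ‖Fin.tail (L z)‖) := by
  set m := p.totalDegree
  -- The factor `X 0` forces `v ≠ 0`, also when the leading form is constant.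
  obtain ⟨v, hv⟩ : ∃ v, eval v (homogeneousComponent m p * X 0) ≠ 0 := by
    by_contra! h
    refine mul_ne_zero (homogeneousComponent_totalDegree_ne_zero hp)
      (X_ne_zero (0 : Fin (n + 1))) ?_
    exact MvPolynomial.funext fun x => by rw [h x, map_zero]
  rw [map_mul, eval_X] at hv
  have hv0 : v ≠ 0 := fun h => hv (by simp [h])
  have he0 : (Pi.single 0 1 : Fin (n + 1) → ℂ) ≠ 0 := by simp
  obtain ⟨L, hL⟩ := SeparatingDual.exists_continuousLinearEquiv_apply_eq (R := ℂ) hv0 he0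
  -- `H` is the homogenization of `p` in the new coordinates. It is non-zero at the point at
  -- infinity `(0, e_0)`, hence on a `δ`-neighbourhood; a zero of `p` violating the bound would
  -- rescale to a zero of `H` in there.
  let H : ℂ × (Fin (n + 1) → ℂ) → ℂ := fun q =>
    ∑ j ∈ Finset.range (m + 1), q.1 ^ (m - j) * eval (L.symm q.2) (homogeneousComponent j p)
  have hHc : Continuous H := by
    refine continuous_finsetSum _ fun j _ => (continuous_fst.pow _).mul ?_
    exact (MvPolynomial.continuous_eval _).comp (L.symm.continuous.comp continuous_snd)
  have hH0 : H (0, Pi.single 0 1) ≠ 0 := by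
    have : H (0, Pi.single 0 1) = eval v (homogeneousComponent m p) := by
      simp only [H]
      rw [Finset.sum_range_succ, Finset.sum_eq_zero, ← hL]
      · simp
      · intro j hj
        rw [zero_pow (by have := Finset.mem_range.mp hj; lia), zero_mul]
    rw [this]
    exact left_ne_zero_of_mul hv
  have hHhom : ∀ (t : ℂ) (w : Fin (n + 1) → ℂ), t ≠ 0 →
      H (t, t • w) = t ^ m * eval (L.symm w) p := by
    intro t w ht
    conv_rhs => rw [← sum_homogeneousComponent p]
    simp only [H, map_smul]
    rw [map_sum, Finset.mul_sum]
    refine Finset.sum_congr rfl fun j hj => ?_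
    rw [eval_smul_of_isHomogeneous (homogeneousComponent_isHomogeneous j p), ← mul_assoc, ← pow_add,
      Nat.sub_add_cancel (by have := Finset.mem_range.mp hj; lia)]
  obtain ⟨δ, hδ, hball⟩ := Metric.eventually_nhds_iff.mp (hHc.continuousAt.eventually_ne hH0)
  refine ⟨L, δ⁻¹, inv_pos.mpr hδ, fun z hz => ?_⟩
  by_contra! hlt
  set w := L z
  have hpos : 0 < ‖w 0‖ := lt_of_le_of_lt (by positivity) hlt
  have hw0 : w 0 ≠ 0 := norm_pos_iff.mp hpos
  have hbig : 1 + ‖Fin.tail w‖ < δ * ‖w 0‖ := by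
    rw [inv_mul_eq_div, div_lt_iff₀ hδ] at hlt
    linarith
  refine hball (y := ((w 0)⁻¹, (w 0)⁻¹ • w)) ?_ ?_
  · rw [Prod.dist_eq, max_lt_iff]
    constructor
    · rw [dist_zero_right, norm_inv, inv_lt_iff_one_lt_mul₀ hpos]
      nlinarith [norm_nonneg (Fin.tail w)]
    · rw [dist_pi_lt_iff hδ]
      refine Fin.cases ?_ fun i => ?_
      · simp [hw0, hδ]
      · have h1 : ‖w i.succ‖ ≤ ‖Fin.tail w‖ := norm_le_pi_norm (Fin.tail w) i
        simp only [Pi.smul_apply, smul_eq_mul, ne_eq, Fin.succ_ne_zero, not_false_eq_true,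
          Pi.single_eq_of_ne, dist_zero_right, norm_mul, norm_inv]
        rw [inv_mul_lt_iff₀ hpos]
        linarith
  · rw [hHhom _ _ (inv_ne_zero hw0), L.symm_apply_apply, hz, mul_zero]

/-- The substitution of linear forms that corresponds to a linear automorphism. -/
def linSubst {n : ℕ} (L : (Fin n → ℂ) →ₗ[ℂ] (Fin n → ℂ)) :
    MvPolynomial (Fin n) ℂ →ₐ[ℂ] MvPolynomial (Fin n) ℂ :=
  aeval fun i => ∑ j, C (L (Pi.single j 1) i) * X j

theorem eval_linSubst {n : ℕ} (L : (Fin n → ℂ) →ₗ[ℂ] (Fin n → ℂ)) (z : Fin n → ℂ)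
    (p : MvPolynomial (Fin n) ℂ) : eval z (linSubst L p) = eval (L z) p := by
  have h : (aeval z : MvPolynomial (Fin n) ℂ →ₐ[ℂ] ℂ).comp (linSubst L) = aeval (L z) := by
    refine MvPolynomial.algHom_ext fun i => ?_
    simp only [linSubst, AlgHom.comp_apply, aeval_X, map_sum, map_mul, algHom_C,
      Algebra.algebraMap_self, RingHom.id_apply]
    conv_rhs => rw [← Finset.univ_sum_single z, map_sum, Finset.sum_apply]
    refine Finset.sum_congr rfl fun j _ => ?_
    have : (Pi.single j (z j) : Fin n → ℂ) = z j • Pi.single j 1 := by simp [← Pi.single_smul]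
    rw [this, map_smul, Pi.smul_apply, smul_eq_mul, mul_comm]
  exact congrArg (fun φ => φ p) h

def linSubstEquiv {n : ℕ} (L : (Fin n → ℂ) ≃ₗ[ℂ] (Fin n → ℂ)) :
    MvPolynomial (Fin n) ℂ ≃ₐ[ℂ] MvPolynomial (Fin n) ℂ :=
  AlgEquiv.ofAlgHom (linSubst L.toLinearMap) (linSubst L.symm.toLinearMap)
    (AlgHom.ext fun p => MvPolynomial.funext fun x => by simp [eval_linSubst])
    (AlgHom.ext fun p => MvPolynomial.funext fun x => by simp [eval_linSubst])

theorem height_vanishingIdeal_image {n : ℕ} (L : (Fin n → ℂ) ≃ₗ[ℂ] (Fin n → ℂ))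
    (V : Set (Fin n → ℂ)) :
    (vanishingIdeal ℂ (L '' V)).height = (vanishingIdeal ℂ V).height := by
  rw [← RingEquiv.height_comap (linSubstEquiv L).toRingEquiv (vanishingIdeal ℂ V)]
  congr 1
  ext p
  have h : ∀ z, eval z (linSubstEquiv L p) = eval (L z) p :=
    fun z => eval_linSubst L.toLinearMap z p
  simp [Ideal.mem_comap, h]

theorem isRadical_vanishingIdeal {n : ℕ} (V : Set (Fin n → ℂ)) :
    (vanishingIdeal ℂ V).IsRadical := by
  rintro p ⟨m, hm⟩ x hx
  have := hm x hx
  rw [map_pow] at this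
  exact eq_zero_of_pow_eq_zero this

/-- Elimination of the first variable. -/
theorem exists_ne_zero_eval_tail_eq_zero {n : ℕ} (V : Set (Fin (n + 1) → ℂ))
    (hV : 2 ≤ (vanishingIdeal ℂ V).height) :
    ∃ g : MvPolynomial (Fin n) ℂ, g ≠ 0 ∧ ∀ z ∈ V, eval (Fin.tail z) g = 0 := by
  -- Polynomials are read as univariate in the first variable, so that elimination is contraction to
  -- the constants.
  let e := (finSuccEquiv ℂ n).symm.toRingEquiv
  let J := (vanishingIdeal ℂ V).comap e
  have hJ : 2 ≤ J.height := by rwa [RingEquiv.height_comap]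
  have hJr : J.IsRadical := (isRadical_vanishingIdeal V).comap e
  obtain ⟨g, hg, hg0⟩ := Submodule.exists_mem_ne_zero_of_ne_bot
    (comap_C_ne_bot_of_two_le_height J hJr hJ)
  refine ⟨g, hg0, fun z hz => ?_⟩
  have h1 : eval z ((finSuccEquiv ℂ n).symm (Polynomial.C g)) = 0 := hg z hz
  have h2 : (finSuccEquiv ℂ n).symm (Polynomial.C g) = rename Fin.succ g := by
    have : (finSuccEquiv ℂ n).toAlgHom.comp (rename Fin.succ) =
        IsScalarTower.toAlgHom ℂ (MvPolynomial (Fin n) ℂ) _ :=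
      MvPolynomial.algHom_ext fun i => by simp [finSuccEquiv_X_succ]
    rw [AlgEquiv.symm_apply_eq]
    exact (congrArg (fun φ => φ g) this).symm
  rw [h2, eval_rename] at h1
  exact h1

/-- The linear map `(z_0, z') ↦ (u z_0, M z')`. -/
def consMap {n : ℕ} (u : ℂˣ) (M : (Fin n → ℂ) ≃ₗ[ℂ] (Fin n → ℂ)) :
    (Fin (n + 1) → ℂ) ≃ₗ[ℂ] (Fin (n + 1) → ℂ) :=
  (Fin.consLinearEquiv ℂ fun _ => ℂ).symm ≪≫ₗ
    (LinearEquiv.smulOfUnit u).prodCongr M ≪≫ₗ Fin.consLinearEquiv ℂ fun _ => ℂ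

theorem exists_unit_norm_mul_le (c : ℝ) (hc : 0 < c) : ∃ u : ℂˣ, ‖(u : ℂ)‖ * c ≤ 1 / 2 := by
  refine ⟨Units.mk0 ((1 / (2 * c) : ℝ) : ℂ) (by exact_mod_cast (by positivity)), ?_⟩
  rw [Units.val_mk0, Complex.norm_real, Real.norm_of_nonneg (by positivity)]
  field_simp
  exact le_rfl

/-- A variety of codimension two lies, in suitable linear coordinates, in a thin cone around the
coordinate subspace spanned by all but the first two basis vectors. -/
theorem exists_linearEquiv_norm_le {n : ℕ} (V : Set (Fin (n + 2) → ℂ))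
    (hV : 2 ≤ (vanishingIdeal ℂ V).height) :
    ∃ L : (Fin (n + 2) → ℂ) ≃ₗ[ℂ] (Fin (n + 2) → ℂ), ∀ z ∈ V,
      ‖L z 0‖ ≤ 1 / 2 * (1 + ‖Fin.tail (Fin.tail (L z))‖) ∧
      ‖L z 1‖ ≤ 1 / 2 * (1 + ‖Fin.tail (Fin.tail (L z))‖) := by
  have hne : vanishingIdeal ℂ V ≠ ⊥ := by
    intro h
    rw [h, Ideal.height_bot] at hV
    exact absurd hV (by norm_num)
  obtain ⟨f, hf, hf0⟩ := Submodule.exists_mem_ne_zero_of_ne_bot hne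
  obtain ⟨L₁, c₁, hc₁, hL₁⟩ := exists_linearEquiv_norm_zero_le hf0
  rw [← height_vanishingIdeal_image L₁.toLinearEquiv] at hV
  obtain ⟨g, hg0, hg⟩ := exists_ne_zero_eval_tail_eq_zero _ hV
  obtain ⟨L₂, c₂, hc₂, hL₂⟩ := exists_linearEquiv_norm_zero_le hg0
  obtain ⟨u₂, hu₂⟩ := exists_unit_norm_mul_le c₂ hc₂
  let M := (L₂.toLinearEquiv.trans (consMap u₂ (LinearEquiv.refl ℂ _))).toContinuousLinearEquiv
  have hM : ∀ y, eval y g = 0 → ‖M y 0‖ ≤ 1 / 2 * (1 + ‖Fin.tail (M y)‖) := by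
    intro y hy
    have h1 : M y 0 = u₂ * L₂ y 0 := rfl
    have h2 : Fin.tail (M y) = Fin.tail (L₂ y) := rfl
    rw [h1, h2, norm_mul]
    calc ‖(u₂ : ℂ)‖ * ‖L₂ y 0‖ ≤ ‖(u₂ : ℂ)‖ * (c₂ * (1 + ‖Fin.tail (L₂ y)‖)) := by
          gcongr; exact hL₂ y hy
      _ = (‖(u₂ : ℂ)‖ * c₂) * (1 + ‖Fin.tail (L₂ y)‖) := by ring
      _ ≤ _ := by gcongr
  set K := ‖(M.symm : (Fin (n + 1) → ℂ) →L[ℂ] (Fin (n + 1) → ℂ))‖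
  -- `u₁` comes after `M`: the first coordinate is bounded through `1 + ‖y‖ ≤ (1 + K) * (1 + t)`.
  obtain ⟨u₁, hu₁⟩ := exists_unit_norm_mul_le (c₁ * (1 + K)) (by positivity)
  refine ⟨L₁.toLinearEquiv.trans (consMap u₁ M.toLinearEquiv), fun z hz => ?_⟩
  have hy := hg (L₁ z) ⟨z, hz, rfl⟩
  set y := Fin.tail (L₁ z)
  have e0 : (L₁.toLinearEquiv.trans (consMap u₁ M.toLinearEquiv)) z 0 = u₁ * L₁ z 0 := rfl
  have e1 : (L₁.toLinearEquiv.trans (consMap u₁ M.toLinearEquiv)) z 1 = M y 0 := rfl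
  have e2 : Fin.tail ((L₁.toLinearEquiv.trans (consMap u₁ M.toLinearEquiv)) z) = M y := rfl
  rw [e0, e1, e2]
  refine ⟨?_, hM y hy⟩
  set t := ‖Fin.tail (M y)‖
  have ht : 0 ≤ t := norm_nonneg _
  have hMy : ‖M y‖ ≤ 1 + t := by
    rw [pi_norm_le_iff_of_nonneg (by positivity)]
    refine Fin.cases ?_ fun i => ?_
    · linarith [hM y hy]
    · have : ‖M y i.succ‖ ≤ t := norm_le_pi_norm (Fin.tail (M y)) i
      linarith
  have hyK : ‖y‖ ≤ K * (1 + t) := by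
    calc ‖y‖ = ‖(M.symm : (Fin (n + 1) → ℂ) →L[ℂ] (Fin (n + 1) → ℂ)) (M y)‖ := by simp
      _ ≤ K * ‖M y‖ := ContinuousLinearMap.le_opNorm _ _
      _ ≤ K * (1 + t) := by gcongr
  rw [norm_mul]
  calc ‖(u₁ : ℂ)‖ * ‖L₁ z 0‖ ≤ ‖(u₁ : ℂ)‖ * (c₁ * ((1 + t) + K * (1 + t))) := by
        gcongr
        refine (hL₁ z (hf z hz)).trans ?_
        gcongr
        linarith
    _ = (‖(u₁ : ℂ)‖ * (c₁ * (1 + K))) * (1 + t) := by ring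
    _ ≤ _ := by gcongr

theorem exists_norm_apply_eq_norm {ι : Type*} [Fintype ι] [Nonempty ι] (x : ι → ℂ) :
    ∃ i, ‖x i‖ = ‖x‖ := by
  obtain ⟨i, hi⟩ := Finite.exists_max fun i => ‖x i‖
  exact ⟨i, le_antisymm (norm_le_pi_norm x i) ((pi_norm_le_iff_of_nonneg (norm_nonneg _)).mpr hi)⟩

theorem mem_Vplus_of_norm_le {k : ℕ} {R : ℝ} {y : Fin k → ℂ} {i : Fin k} (hi : i.val ≠ 0)
    (hRi : R ≤ ‖y i‖) (h0 : ∀ j : Fin k, j.val = 0 → ‖y j‖ ≤ ‖y i‖) : y ∈ Vplus k R := by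
  have : Nonempty (Fin k) := ⟨i⟩
  obtain ⟨j, hj⟩ := exists_norm_apply_eq_norm y
  by_cases hj0 : j.val = 0
  · exact ⟨i, hi, le_antisymm (hj ▸ h0 j hj0) (norm_le_pi_norm y i), hRi⟩
  · exact ⟨j, hj0, hj.symm, hRi.trans ((norm_le_pi_norm y i).trans hj.ge)⟩

/-- Let `t` be the norm of the coordinates beyond the second. If `t < R`, the first two coordinates
of `w` are smaller than `R`, so after the shift by `2R` the second exceeds `R` and dominates the
first. If `t ≥ R > 1`, an untouched coordinate of size `t` dominates `(1 + t) / 2`. -/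
theorem translate_mem_Vplus {n : ℕ} {R : ℝ} (hR : 1 < R) (w : Fin (n + 2) → ℂ)
    (h0 : ‖w 0‖ ≤ 1 / 2 * (1 + ‖Fin.tail (Fin.tail w)‖))
    (h1 : ‖w 1‖ ≤ 1 / 2 * (1 + ‖Fin.tail (Fin.tail w)‖)) :
    translate (n + 2) R w ∈ Vplus (n + 2) R := by
  set y := translate (n + 2) R w
  set t := ‖Fin.tail (Fin.tail w)‖
  have hy0 : y 0 = w 0 := by simp [y, translate]
  have hy1 : y 1 = w 1 + ((2 * R : ℝ) : ℂ) := by simp [y, translate]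
  have hy2 : ∀ i : Fin n, y i.succ.succ = w i.succ.succ := fun i => by simp [y, translate]
  have hle : ∀ i : Fin n, ‖y i.succ.succ‖ ≤ t := fun i => by
    rw [hy2]; exact norm_le_pi_norm (Fin.tail (Fin.tail w)) i
  have hmain : ∃ i : Fin (n + 2), i.val ≠ 0 ∧ R ≤ ‖y i‖ ∧ ‖y 0‖ ≤ ‖y i‖ := by
    by_cases ht : t < R
    · have : R ≤ ‖y 1‖ := by
        rw [hy1]
        have h3 := norm_sub_le (w 1 + ((2 * R : ℝ) : ℂ)) (w 1)
        rw [add_sub_cancel_left, Complex.norm_real, Real.norm_of_nonneg (by linarith)] at h3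
        linarith
      exact ⟨1, by simp, this, by rw [hy0]; linarith⟩
    · have hn : Nonempty (Fin n) := by
        by_contra hn
        rw [not_nonempty_iff] at hn
        have : t = 0 := by simp [t, Subsingleton.elim (Fin.tail (Fin.tail w)) 0]
        linarith
      obtain ⟨i, hi⟩ := exists_norm_apply_eq_norm (Fin.tail (Fin.tail w))
      have : ‖y i.succ.succ‖ = t := by rw [hy2]; exact hi
      exact ⟨i.succ.succ, by simp, by linarith, by rw [hy0]; linarith⟩
  obtain ⟨i, hi, hRi, h0i⟩ := hmain
  refine mem_Vplus_of_norm_le hi hRi fun j hj => ?_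
  rwa [show j = 0 from Fin.ext hj]

end Growth

/-! ### Plurisubharmonic functions -/

section Psh

open Real

theorem circleIntegrable_of_continuous {f : ℂ → ℝ} (hf : Continuous f) (c : ℂ) (R : ℝ) :
    CircleIntegrable f c R :=
  (hf.comp (continuous_circleMap c R)).intervalIntegrable _ _

/-- Jensen's formula: the zeros of `f` in the disc contribute non-negative terms. -/
theorem log_norm_le_circleAverage {f : ℂ → ℂ} (hf : Differentiable ℂ f) (h0 : f 0 ≠ 0) :
    log ‖f 0‖ ≤ circleAverage (fun ζ => log ‖f ζ‖) 0 1 := by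
  have han : AnalyticOnNhd ℂ f (Metric.closedBall 0 |1|) := fun z _ => hf.analyticAt z
  rw [han.circleAverage_log_norm one_ne_zero h0]
  have : 0 ≤ ∑ᶠ u, (MeromorphicOn.divisor f (Metric.closedBall 0 |1|) u : ℝ) *
      log (1 * ‖(0 : ℂ) - u‖⁻¹) := by
    refine finsum_nonneg fun u => ?_
    by_cases hu : u ∈ Metric.closedBall (0 : ℂ) |1|
    · refine mul_nonneg ?_ ?_
      · exact_mod_cast (MeromorphicOn.AnalyticOnNhd.divisor_nonneg han) u
      · rw [zero_sub, norm_neg, one_mul, log_inv]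
        have : ‖u‖ ≤ 1 := by simpa using hu
        linarith [log_nonpos (norm_nonneg u) this]
    · rw [Function.locallyFinsuppWithin.apply_eq_zero_of_notMem _ hu]
      simp
  linarith

/-- `log⁺ ‖f‖` is the maximum of `0` and the `log ‖f i‖`; it suffices to use the one that attains it
at `0`. -/
theorem posLog_norm_le_circleAverage {k : ℕ} {f : ℂ → Fin k → ℂ} (hf : Differentiable ℂ f) :
    log⁺ ‖f 0‖ ≤ circleAverage (fun ζ => log⁺ ‖f ζ‖) 0 1 := by
  have hcont : Continuous fun ζ => log⁺ ‖f ζ‖ := continuous_posLog.comp hf.continuous.norm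
  rcases le_or_gt ‖f 0‖ 1 with h | h
  · rw [(posLog_eq_zero_iff _).mpr (by rwa [abs_norm])]
    exact circleAverage_nonneg_of_nonneg fun _ _ => posLog_nonneg
  · have : Nonempty (Fin k) := by
      by_contra hk
      rw [not_nonempty_iff] at hk
      rw [Subsingleton.elim (f 0) 0, norm_zero] at h
      linarith
    obtain ⟨i, hi⟩ := exists_norm_apply_eq_norm (f 0)
    have hfi : Differentiable ℂ fun ζ => f ζ i := differentiable_pi.mp hf i
    have h0 : f 0 i ≠ 0 := norm_pos_iff.mp (by rw [hi]; linarith)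
    rw [posLog_eq_log (by rw [abs_norm]; exact h.le), ← hi]
    refine (log_norm_le_circleAverage hfi h0).trans (circleAverage_mono ?_
      (circleIntegrable_of_continuous hcont _ _) fun ζ _ => ?_)
    · exact MeromorphicOn.circleIntegrable_log_norm fun z _ => (hfi.analyticAt z).meromorphicAt
    · exact (le_max_right _ _).trans (posLog_le_posLog (norm_nonneg _) (norm_le_pi_norm (f ζ) i))

/-- The limit of a decreasing sequence of non-negative continuous plurisubharmonic functions. -/
theorem isPlurisubharmonic_iInf {k : ℕ} {u : ℕ → (Fin k → ℂ) → ℝ} (hu : ∀ n, Continuous (u n))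
    (h0 : ∀ n z, 0 ≤ u n z) (hanti : ∀ z, Antitone fun n => u n z)
    (hsub : ∀ n z w, u n z ≤ circleAverage (fun ζ : ℂ => u n (z + ζ • w)) 0 1) (c : ℝ) :
    IsPlurisubharmonic fun z => c + ⨅ n, u n z := by
  have hbdd : ∀ z, BddBelow (Set.range fun n => u n z) := fun z =>
    ⟨0, by rintro _ ⟨n, rfl⟩; exact h0 n z⟩
  have hinf : UpperSemicontinuous fun z => ⨅ n, u n z :=
    upperSemicontinuous_ciInf hbdd fun n => (hu n).upperSemicontinuous
  refine ⟨upperSemicontinuous_const.add hinf, fun z w => ?_⟩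
  have hline : Continuous fun ζ : ℂ => z + ζ • w := by fun_prop
  have hc : ∀ n, Continuous fun ζ : ℂ => u n (z + ζ • w) := fun n => (hu n).comp hline
  have hi : ∀ n, CircleIntegrable (fun ζ : ℂ => u n (z + ζ • w)) 0 1 := fun n =>
    circleIntegrable_of_continuous (hc n) _ _
  have hmeas : Measurable fun ζ : ℂ => ⨅ n, u n (z + ζ • w) :=
    Measurable.iInf fun n => (hc n).measurable
  have hle : ∀ y n, ⨅ n, u n y ≤ u n y := fun y n => ciInf_le (hbdd y) n
  have hnn : ∀ y, 0 ≤ ⨅ n, u n y := fun y => le_ciInf fun n => h0 n y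
  have hint : CircleIntegrable (fun ζ : ℂ => ⨅ n, u n (z + ζ • w)) 0 1 := by
    refine (hi 0).mono_fun (hmeas.comp (continuous_circleMap 0 1).measurable).aestronglyMeasurable
      (Filter.Eventually.of_forall fun θ => ?_)
    simp only [norm_eq_abs, abs_of_nonneg (hnn _), abs_of_nonneg (h0 _ _)]
    exact hle _ 0
  -- The sub-mean value inequality passes to the limit by dominated convergence, with `u 0` as
  -- majorant.
  have hlim : Filter.Tendsto (fun n => circleAverage (fun ζ : ℂ => u n (z + ζ • w)) 0 1)
      Filter.atTop (𝓝 (circleAverage (fun ζ : ℂ => ⨅ n, u n (z + ζ • w)) 0 1)) := by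
    refine Filter.Tendsto.const_smul ?_ _
    refine intervalIntegral.tendsto_integral_filter_of_dominated_convergence
      (fun θ => u 0 (z + circleMap 0 1 θ • w)) ?_ ?_ (hi 0) ?_
    · exact Filter.Eventually.of_forall fun n =>
        ((hc n).comp (continuous_circleMap 0 1)).aestronglyMeasurable
    · refine Filter.Eventually.of_forall fun n => Filter.Eventually.of_forall fun θ _ => ?_
      rw [norm_eq_abs, abs_of_nonneg (h0 _ _)]
      exact hanti _ (Nat.zero_le n)
    · exact Filter.Eventually.of_forall fun θ _ => tendsto_atTop_ciInf (hanti _) (hbdd _)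
  have hconst : CircleIntegrable (fun _ : ℂ => c) 0 1 :=
    circleIntegrable_of_continuous continuous_const _ _
  refine ⟨hconst.add hint, ?_⟩
  rw [circleAverage_fun_add hconst hint, circleAverage_const]
  refine add_le_add le_rfl ?_
  exact ge_of_tendsto hlim (Filter.Eventually.of_forall fun n => (hle z n).trans (hsub n z w))

end Psh

/-! ### Affine images -/

section Affine

theorem translate_eq_add (k : ℕ) (R : ℝ) (z : Fin k → ℂ) :
    translate k R z = z + translate k R 0 := by
  ext i; simp [translate]

theorem IsShortCk.preimage_affine {k : ℕ} {Ω : Set (Fin k → ℂ)} (h : IsShortCk Ω)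
    (L : (Fin k → ℂ) ≃ₗ[ℂ] (Fin k → ℂ)) (b : Fin k → ℂ) :
    IsShortCk ((fun z => L z + b) ⁻¹' Ω) := by
  let L' := L.toContinuousLinearEquiv
  let T : (Fin k → ℂ) ≃ₜ (Fin k → ℂ) := L'.toHomeomorph.trans (Homeomorph.addRight b)
  have hT : ∀ z, T z = L z + b := fun _ => rfl
  have hdT : Differentiable ℂ T := by
    change Differentiable ℂ fun z => L' z + b
    fun_prop
  have hdS : Differentiable ℂ T.symm := by
    change Differentiable ℂ fun z => L'.symm (z + -b)
    fun_prop
  change IsShortCk (T ⁻¹' Ω)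
  refine ⟨h.isOpen.preimage T.continuous, T.isConnected_preimage.mpr h.isConnected, ?_, ?_, ?_⟩
  · obtain ⟨U, hU, hΩ⟩ := h.exhaustion
    refine ⟨fun j => T ⁻¹' U j, fun j => ⟨(hU j).1.preimage T.continuous,
      Set.preimage_mono (hU j).2.1, ?_⟩, by rw [hΩ, Set.preimage_iUnion]⟩
    obtain ⟨f, g, hf, hg, hfm, hgm, hl, hr⟩ := (hU j).2.2
    refine ⟨f ∘ T, T.symm ∘ g, hf.comp hdT.differentiableOn fun _ hz => hz,
      hdS.comp_differentiableOn hg, fun z hz => hfm hz, fun z hz => ?_, fun z hz => ?_,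
      fun z hz => ?_⟩
    · simpa using hgm hz
    · simp [hl (show T z ∈ U j from hz)]
    · simpa using hr hz
  · intro p hp ξ
    refine le_antisymm ?_ zero_le
    rw [← h.kobayashi_eq_zero (T p) hp (L ξ)]
    refine le_iInf₂ fun α hα => ?_
    obtain ⟨hα0, f, hf, hfm, hf0, hfd⟩ := hα
    refine iInf₂_le α ⟨hα0, T.symm ∘ f, hdS.comp_differentiableOn hf, fun z hz => ?_, ?_, ?_⟩
    · simpa using hfm hz
    · simp [hf0]
    · have hd : HasDerivAt f (deriv f 0) 0 :=
        (hf.differentiableAt (Metric.ball_mem_nhds 0 one_pos)).hasDerivAt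
      have h1 : HasDerivAt (T.symm ∘ f) (L'.symm (deriv f 0)) 0 :=
        (L'.symm : (Fin k → ℂ) →L[ℂ] (Fin k → ℂ)).hasFDerivAt.comp_hasDerivAt 0 (hd.add_const (-b))
      rw [h1.deriv, ← map_smul, hfd]
      exact L.symm_apply_apply ξ
  · obtain ⟨φ, ⟨hus, hsub⟩, hbd, hΩ, p, hp, q, hq, hpq⟩ := h.exists_psh
    refine ⟨φ ∘ T, ⟨hus.comp T.continuous, fun z w => ?_⟩,
      hbd.mono (Set.range_comp_subset_range _ _),
      by rw [hΩ]; rfl, T.symm p, by simpa using hp, T.symm q, by simpa using hq, by simpa using hpq⟩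
    have : (fun ζ : ℂ => (φ ∘ T) (z + ζ • w)) = fun ζ : ℂ => φ (T z + ζ • L w) := by
      ext ζ
      simp only [Function.comp_apply, hT, map_add, map_smul]
      congr 1
      abel
    rw [this]
    exact hsub (T z) (L w)

end Affine

/-! ### Basins of sequences of automorphisms -/

section Basin

variable {k : ℕ} {F : ℕ → (Fin k → ℂ) → (Fin k → ℂ)}

theorem exists_inverse_iterSeq (hF : ∀ n, ∃ G, Differentiable ℂ G ∧
      Function.LeftInverse G (F n) ∧ Function.RightInverse G (F n)) (n : ℕ) :
    ∃ H, Differentiable ℂ H ∧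
      Function.LeftInverse H (iterSeq F n) ∧ Function.RightInverse H (iterSeq F n) := by
  induction n with
  | zero => exact hF 0
  | succ n ih =>
    obtain ⟨H, hH, hl, hr⟩ := ih
    obtain ⟨G, hG, hGl, hGr⟩ := hF (n + 1)
    exact ⟨H ∘ G, hH.comp hG, hGl.comp hl, hGr.comp hr⟩

theorem differentiable_iterSeq (hF : ∀ n, Differentiable ℂ (F n)) (n : ℕ) :
    Differentiable ℂ (iterSeq F n) := by
  induction n with
  | zero => exact hF 0
  | succ n ih => exact (hF (n + 1)).comp ih

theorem iterSeq_apply_zero (hF : ∀ n, F n 0 = 0) (n : ℕ) : iterSeq F n 0 = 0 := by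
  induction n with
  | zero => exact hF 0
  | succ n ih => rw [iterSeq, Function.comp_apply, ih, hF]

theorem zero_mem_basin (hF : ∀ n, F n 0 = 0) : (0 : Fin k → ℂ) ∈ basin F := by
  simp [basin, iterSeq_apply_zero hF]

/-- The Euclidean norm on `Fin k → ℂ`. -/
def eucNorm (z : Fin k → ℂ) : ℝ := ‖(WithLp.toLp 2 z : EuclideanSpace ℂ (Fin k))‖

theorem eucNorm_sq (z : Fin k → ℂ) : eucNorm z ^ 2 = ∑ i, ‖z i‖ ^ 2 :=
  EuclideanSpace.norm_sq_eq _

theorem eucNorm_nonneg (z : Fin k → ℂ) : 0 ≤ eucNorm z := norm_nonneg _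

theorem eucNorm_add_le (z w : Fin k → ℂ) : eucNorm (z + w) ≤ eucNorm z + eucNorm w := by
  rw [eucNorm, WithLp.toLp_add]
  exact norm_add_le _ _

theorem eucNorm_smul (c : ℂ) (z : Fin k → ℂ) : eucNorm (c • z) = ‖c‖ * eucNorm z := by
  rw [eucNorm, WithLp.toLp_smul, norm_smul]; rfl

theorem continuous_eucNorm : Continuous (eucNorm : (Fin k → ℂ) → ℝ) :=
  (PiLp.continuous_toLp 2 fun _ : Fin k => ℂ).norm

theorem norm_le_eucNorm (z : Fin k → ℂ) : ‖z‖ ≤ eucNorm z := by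
  refine (pi_norm_le_iff_of_nonneg (eucNorm_nonneg z)).mpr fun i => ?_
  exact PiLp.norm_apply_le (WithLp.toLp 2 z : EuclideanSpace ℂ (Fin k)) i

theorem eucNorm_le_of_norm_le {c : ℝ} (hc : 0 ≤ c) {z w : Fin k → ℂ}
    (h : ∀ i, ‖w i‖ ≤ c * ‖z i‖) : eucNorm w ≤ c * eucNorm z := by
  refine (sq_le_sq₀ (eucNorm_nonneg w) (mul_nonneg hc (eucNorm_nonneg z))).mp ?_
  rw [mul_pow, eucNorm_sq, eucNorm_sq, Finset.mul_sum]
  refine Finset.sum_le_sum fun i _ => ?_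
  rw [← mul_pow]
  exact pow_le_pow_left₀ (norm_nonneg _) (h i) 2

theorem mem_unitBall_iff (z : Fin k → ℂ) : z ∈ unitBall k ↔ eucNorm z < 1 := by
  change ∑ i, ‖z i‖ ^ 2 < 1 ↔ _
  rw [← eucNorm_sq, sq_lt_one_iff₀ (eucNorm_nonneg z)]

/-- The Euclidean ball of radius `1 / 2`. -/
def halfBall (k : ℕ) : Set (Fin k → ℂ) := {z | eucNorm z < 1 / 2}

theorem isOpen_halfBall : IsOpen (halfBall k) := isOpen_lt continuous_eucNorm continuous_const

theorem eucNorm_zero : eucNorm (0 : Fin k → ℂ) = 0 := by simp [eucNorm]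

theorem zero_mem_halfBall : (0 : Fin k → ℂ) ∈ halfBall k := by
  simp [halfBall, eucNorm_zero]

theorem isConnected_halfBall : IsConnected (halfBall k) := by
  refine ⟨⟨0, zero_mem_halfBall⟩, Convex.isPreconnected ?_⟩
  intro z hz w hw s t hs ht hst
  have hz' : eucNorm z < 1 / 2 := hz
  have hw' : eucNorm w < 1 / 2 := hw
  have h1 := eucNorm_add_le (s • z) (t • w)
  have h2 : eucNorm (s • z) = s * eucNorm z := by
    have := eucNorm_smul (s : ℂ) z
    rwa [Complex.norm_real, Real.norm_of_nonneg hs, Complex.coe_smul] at this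
  have h3 : eucNorm (t • w) = t * eucNorm w := by
    have := eucNorm_smul (t : ℂ) w
    rwa [Complex.norm_real, Real.norm_of_nonneg ht, Complex.coe_smul] at this
  rw [h2, h3] at h1
  change eucNorm _ < 1 / 2
  rcases hs.eq_or_lt with rfl | hs
  · nlinarith
  · nlinarith

/-- `F` is a sequence of automorphisms that from the index `N` on attract the half ball to the
origin. -/
structure IsAttracting (F : ℕ → (Fin k → ℂ) → (Fin k → ℂ)) (N : ℕ) : Prop where
  differentiable : ∀ n, Differentiable ℂ (F n)
  exists_inverse : ∀ n, ∃ G, Differentiable ℂ G ∧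
    Function.LeftInverse G (F n) ∧ Function.RightInverse G (F n)
  map_zero : ∀ n, F n 0 = 0
  eucNorm_le : ∀ n, N ≤ n → ∀ z ∈ halfBall k, eucNorm (F n z) ≤ 3 / 4 * eucNorm z

namespace IsAttracting

variable {N : ℕ}

theorem mapsTo_halfBall (hF : IsAttracting F N) {n : ℕ} (hn : N ≤ n) :
    Set.MapsTo (F n) (halfBall k) (halfBall k) := by
  intro z hz
  have h := hF.eucNorm_le n hn z hz
  have hz' : eucNorm z < 1 / 2 := hz
  change eucNorm _ < 1 / 2
  linarith [eucNorm_nonneg z]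

theorem eucNorm_iterSeq_le (hF : IsAttracting F N) {n : ℕ} (hn : N ≤ n) {z : Fin k → ℂ}
    (hz : iterSeq F n z ∈ halfBall k) (j : ℕ) :
    iterSeq F (n + j) z ∈ halfBall k ∧
      eucNorm (iterSeq F (n + j) z) ≤ (3 / 4) ^ j * eucNorm (iterSeq F n z) := by
  induction j with
  | zero => exact ⟨hz, by simp⟩
  | succ j ih =>
    refine ⟨hF.mapsTo_halfBall (by lia) ih.1, ?_⟩
    refine (hF.eucNorm_le (n + j + 1) (by lia) _ ih.1).trans ?_
    rw [pow_succ']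
    linarith [ih.2]

theorem mem_basin (hF : IsAttracting F N) {n : ℕ} (hn : N ≤ n) {z : Fin k → ℂ}
    (hz : iterSeq F n z ∈ halfBall k) : z ∈ basin F := by
  change Filter.Tendsto _ _ _
  rw [← Filter.tendsto_add_atTop_iff_nat n]
  refine squeeze_zero_norm (a := fun j => (3 / 4 : ℝ) ^ j * eucNorm (iterSeq F n z))
    (fun j => ?_) ?_
  · rw [add_comm j n]
    exact (norm_le_eucNorm _).trans (hF.eucNorm_iterSeq_le hn hz j).2
  · simpa using (tendsto_pow_atTop_nhds_zero_of_lt_one (r := (3 / 4 : ℝ)) (by norm_num)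
      (by norm_num)).mul_const (eucNorm (iterSeq F n z))

theorem basin_eq_iUnion (hF : IsAttracting F N) :
    basin F = ⋃ j, iterSeq F (N + j) ⁻¹' halfBall k := by
  ext z
  rw [Set.mem_iUnion]
  constructor
  · intro hz
    have h1 := (Filter.Tendsto.eventually_mem hz (isOpen_halfBall.mem_nhds zero_mem_halfBall)).and
      (Filter.eventually_ge_atTop N)
    obtain ⟨n, hn, hNn⟩ := h1.exists
    exact ⟨n - N, by rwa [Nat.add_sub_cancel' hNn]⟩
  · rintro ⟨j, hj⟩
    exact hF.mem_basin (Nat.le_add_right N j) hj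

theorem preimage_halfBall_subset (hF : IsAttracting F N) (j : ℕ) :
    iterSeq F (N + j) ⁻¹' halfBall k ⊆ iterSeq F (N + (j + 1)) ⁻¹' halfBall k :=
  fun _ hz => (hF.eucNorm_iterSeq_le (Nat.le_add_right N j) hz 1).1

theorem isOpen_preimage (hF : IsAttracting F N) (n : ℕ) : IsOpen (iterSeq F n ⁻¹' halfBall k) :=
  isOpen_halfBall.preimage (differentiable_iterSeq hF.differentiable n).continuous

theorem isOpen_basin (hF : IsAttracting F N) : IsOpen (basin F) := by
  rw [hF.basin_eq_iUnion]
  exact isOpen_iUnion fun j => hF.isOpen_preimage _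

theorem isConnected_basin (hF : IsAttracting F N) : IsConnected (basin F) := by
  refine ⟨⟨0, zero_mem_basin hF.map_zero⟩, ?_⟩
  rw [hF.basin_eq_iUnion]
  refine isPreconnected_iUnion ⟨0, Set.mem_iInter.mpr fun j => ?_⟩ fun j => ?_
  · rw [Set.mem_preimage, iterSeq_apply_zero hF.map_zero]
    exact zero_mem_halfBall
  · obtain ⟨H, hH, hl, hr⟩ := exists_inverse_iterSeq hF.exists_inverse (N + j)
    rw [← Set.image_eq_preimage_of_inverse hr hl]
    exact isConnected_halfBall.isPreconnected.image _ hH.continuous.continuousOn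

theorem biholomorphic_preimage (hF : IsAttracting F N) (n : ℕ) :
    Biholomorphic (iterSeq F n ⁻¹' halfBall k) (unitBall k) := by
  obtain ⟨H, hH, hl, hr⟩ := exists_inverse_iterSeq hF.exists_inverse n
  refine ⟨fun z => (2 : ℂ) • iterSeq F n z, fun w => H ((2 : ℂ)⁻¹ • w), ?_, ?_, ?_, ?_, ?_, ?_⟩
  · exact ((differentiable_iterSeq hF.differentiable n).const_smul (2 : ℂ)).differentiableOn
  · exact (hH.comp (differentiable_id.const_smul (2 : ℂ)⁻¹)).differentiableOn
  · intro z hz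
    have hz' : eucNorm (iterSeq F n z) < 1 / 2 := hz
    rw [mem_unitBall_iff, eucNorm_smul, Complex.norm_ofNat]
    linarith
  · intro w hw
    rw [mem_unitBall_iff] at hw
    rw [Set.mem_preimage, hr]
    change eucNorm _ < 1 / 2
    rw [eucNorm_smul, norm_inv, Complex.norm_ofNat]
    linarith
  · intro z _
    simp [hl z]
  · intro w _
    simp [hr _]

/-- With `s = 1 / ε`, the affine disc through `F(n) p` in the direction `s • DF(n) ξ` lies in the
half ball for large `n`. Its pullback by the inverse of `F(n)` is a disc in the basin with
derivative `s • ξ` at `p`. -/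
theorem kobayashiMetric_basin_eq_zero (hF : IsAttracting F N) {p : Fin k → ℂ} (hp : p ∈ basin F)
    (hD : Filter.Tendsto (fun n => fderiv ℂ (iterSeq F n) p) Filter.atTop (𝓝 0)) (ξ : Fin k → ℂ) :
    kobayashiMetric (basin F) p ξ = 0 := by
  refine le_antisymm (ENNReal.le_of_forall_pos_le_add fun ε hε _ => ?_) zero_le
  rw [zero_add]
  have hε' : (((ε : ℝ≥0) : ℝ) : ℂ) ≠ 0 := by exact_mod_cast hε.ne'
  set s : ℂ := (((ε : ℝ≥0) : ℝ) : ℂ)⁻¹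
  have hlim : Filter.Tendsto (fun n => eucNorm (iterSeq F n p) +
      eucNorm (s • fderiv ℂ (iterSeq F n) p ξ)) Filter.atTop (𝓝 0) := by
    have h1 : Filter.Tendsto (fun n => eucNorm (iterSeq F n p)) Filter.atTop (𝓝 0) := by
      simpa [eucNorm_zero, Function.comp_def] using (continuous_eucNorm.tendsto 0).comp hp
    have h2 : Filter.Tendsto (fun n => fderiv ℂ (iterSeq F n) p ξ) Filter.atTop (𝓝 0) := by
      simpa [Function.comp_def] using
        ((ContinuousLinearMap.apply ℂ (Fin k → ℂ) ξ).continuous.tendsto 0).comp hD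
    have h3 : Filter.Tendsto (fun n => eucNorm (s • fderiv ℂ (iterSeq F n) p ξ)) Filter.atTop
        (𝓝 0) := by
      simpa [eucNorm_smul, eucNorm_zero] using
        ((continuous_eucNorm.tendsto 0).comp h2).const_mul ‖s‖
    simpa using h1.add h3
  obtain ⟨n, hn, hNn⟩ := ((hlim.eventually_lt_const (show (0 : ℝ) < 1 / 2 by norm_num)).and
    (Filter.eventually_ge_atTop N)).exists
  obtain ⟨H, hH, hl, hr⟩ := exists_inverse_iterSeq hF.exists_inverse n
  set v := s • fderiv ℂ (iterSeq F n) p ξ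
  refine iInf₂_le ε ⟨hε, fun ζ => H (iterSeq F n p + ζ • v), ?_, ?_, ?_, ?_⟩
  · have : Differentiable ℂ fun ζ : ℂ => iterSeq F n p + ζ • v := by fun_prop
    exact (hH.comp this).differentiableOn
  · intro ζ hζ
    refine hF.mem_basin hNn ?_
    rw [hr]
    change eucNorm _ < 1 / 2
    refine (eucNorm_add_le _ _).trans_lt (lt_of_le_of_lt ?_ hn)
    rw [eucNorm_smul]
    have : ‖ζ‖ ≤ 1 := by simpa using (Metric.mem_ball.mp hζ).le
    nlinarith [eucNorm_nonneg v]
  · simp [hl p]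
  · have hline : HasDerivAt (fun ζ : ℂ => iterSeq F n p + ζ • v) v 0 := by
      simpa using ((hasDerivAt_id (0 : ℂ)).smul_const v).const_add (iterSeq F n p)
    have hHd : HasFDerivAt H (fderiv ℂ H (iterSeq F n p)) (iterSeq F n p + (0 : ℂ) • v) := by
      simpa using (hH (iterSeq F n p)).hasFDerivAt
    have hd := hHd.comp_hasDerivAt 0 hline
    have hcomp : fderiv ℂ H (iterSeq F n p) (fderiv ℂ (iterSeq F n) p ξ) = ξ := by
      have h1 : HasFDerivAt (H ∘ iterSeq F n)
          ((fderiv ℂ H (iterSeq F n p)).comp (fderiv ℂ (iterSeq F n) p)) p :=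
        (hH _).hasFDerivAt.comp p (differentiable_iterSeq hF.differentiable n p).hasFDerivAt
      rw [hl.comp_eq_id] at h1
      exact congrArg (fun φ => φ ξ) (h1.unique (hasFDerivAt_id p))
    change _ • deriv (H ∘ fun ζ : ℂ => iterSeq F n p + ζ • v) 0 = ξ
    rw [hd.deriv, map_smul, hcomp, smul_inv_smul₀ hε']

end IsAttracting

end Basin

/-! ### The shift maps -/

section ShiftMap

theorem norm_shiftMap_le {k d : ℕ} (η : ℂ) (z : Fin k → ℂ) :
    ‖shiftMap k d η z‖ ≤ ‖z‖ ^ d + ‖η‖ * ‖z‖ := by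
  refine (pi_norm_le_iff_of_nonneg (by positivity)).mpr fun i => (norm_add_le _ _).trans ?_
  rw [norm_mul]
  gcongr
  · split_ifs
    · rw [norm_zero]; positivity
    · rw [norm_pow]
      gcongr
      exact norm_le_pi_norm z i
  · exact norm_le_pi_norm z _

theorem norm_shiftMap_apply_ge {k : ℕ} (d : ℕ) (η : ℂ) (z : Fin k → ℂ) (i : Fin k)
    (hi : i.val ≠ 0) :
    ‖z i‖ ^ d - ‖η‖ * ‖z‖ ≤ ‖shiftMap k d η z i‖ := by
  have h1 : ‖z i ^ d‖ - ‖η * z ((finRotate k).symm i)‖ ≤ ‖shiftMap k d η z i‖ := by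
    simp only [shiftMap, if_neg hi]
    simpa using norm_sub_norm_le (z i ^ d) (-(η * z ((finRotate k).symm i)))
  rw [norm_pow, norm_mul] at h1
  have h2 := mul_le_mul_of_nonneg_left (norm_le_pi_norm z ((finRotate k).symm i)) (norm_nonneg η)
  linarith

/-- For `‖z‖ ≥ R > 1 + a`, the `i`-th coordinate of the image has size at least `‖z‖ (‖z‖ - a) ≥
‖z‖`, while the one of index `0` has size at most `a ‖z‖`. -/
theorem shiftMap_mem_Vplus {k d : ℕ} (hd : 2 ≤ d) {η : ℂ} {a R : ℝ} (ha : 0 < a) (ha1 : a < 1)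
    (hη : ‖η‖ ≤ a) (hR : 1 + a < R) {z : Fin k → ℂ} (hz : z ∈ Vplus k R) :
    shiftMap k d η z ∈ Vplus k R := by
  obtain ⟨i, hi, hzi, hRi⟩ := hz
  rw [← hzi] at hRi
  have hbig : ‖z‖ ≤ ‖shiftMap k d η z i‖ := by
    have h1 := norm_shiftMap_apply_ge d η z i hi
    rw [← hzi] at h1
    have h2 : ‖z‖ ^ 2 ≤ ‖z‖ ^ d := pow_le_pow_right₀ (by linarith) hd
    have h3 : ‖η‖ * ‖z‖ ≤ a * ‖z‖ := by gcongr
    nlinarith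
  refine mem_Vplus_of_norm_le hi (hRi.trans hbig) fun j hj => ?_
  refine le_trans ?_ hbig
  have h1 : shiftMap k d η z j = η * z ((finRotate k).symm j) := by simp [shiftMap, hj]
  rw [h1, norm_mul]
  nlinarith [norm_le_pi_norm z ((finRotate k).symm j), norm_nonneg (z ((finRotate k).symm j))]

theorem disjoint_basin_Vplus {k d : ℕ} (hd : 2 ≤ d) {η : ℕ → ℂ} {a R : ℝ} (ha : 0 < a)
    (ha1 : a < 1) (hη : ∀ n, ‖η n‖ ≤ a) (hR : 1 + a < R) :
    Disjoint (basin fun n => shiftMap k d (η n)) (Vplus k R) := by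
  refine Set.disjoint_left.mpr fun z hz hzV => ?_
  have hmem : ∀ n, iterSeq (fun n => shiftMap k d (η n)) n z ∈ Vplus k R := by
    intro n
    induction n with
    | zero => exact shiftMap_mem_Vplus hd ha ha1 (hη 0) hR hzV
    | succ n ih => exact shiftMap_mem_Vplus hd ha ha1 (hη (n + 1)) hR ih
  have h1 : Filter.Tendsto _ _ _ := (tendsto_zero_iff_norm_tendsto_zero.mp hz)
  obtain ⟨n, hn⟩ := (h1.eventually_lt_const (show (0 : ℝ) < R by linarith)).exists
  obtain ⟨i, -, hi, hRi⟩ := hmem n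
  linarith

theorem finRotate_symm_zero (n : ℕ) : (finRotate (n + 1)).symm 0 = Fin.last n := by
  rw [Equiv.symm_apply_eq, finRotate_last]

theorem finRotate_symm_succ {n : ℕ} (j : Fin n) : (finRotate (n + 1)).symm j.succ = j.castSucc := by
  rw [Equiv.symm_apply_eq]
  ext
  rw [coe_finRotate_of_ne_last (Fin.castSucc_lt_last j).ne]
  simp

theorem shiftMap_apply_zero {n d : ℕ} (η : ℂ) (z : Fin (n + 1) → ℂ) :
    shiftMap (n + 1) d η z 0 = η * z (Fin.last n) := by
  simp only [shiftMap, finRotate_symm_zero, Fin.val_zero, if_true, zero_add]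

theorem shiftMap_apply_succ {n d : ℕ} (η : ℂ) (z : Fin (n + 1) → ℂ) (j : Fin n) :
    shiftMap (n + 1) d η z j.succ = z j.succ ^ d + η * z j.castSucc := by
  simp only [shiftMap, finRotate_symm_succ, Fin.val_succ, Nat.succ_ne_zero, if_false]

/-- The coordinates of the inverse of `shiftMap`, counted from the last one. -/
def shiftMapInvCoord {n : ℕ} (d : ℕ) (η : ℂ) (w : Fin (n + 1) → ℂ) : ℕ → ℂ
  | 0 => η⁻¹ * w 0
  | m + 1 => η⁻¹ * (w ⟨n - m, by lia⟩ - shiftMapInvCoord d η w m ^ d)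

/-- The system is triangular: the coordinate of index `0` of the image yields the last coordinate of
`z`, and each coordinate then yields its predecessor. -/
theorem exists_inverse_shiftMap {n : ℕ} (d : ℕ) {η : ℂ} (hη : η ≠ 0) :
    ∃ G : (Fin (n + 1) → ℂ) → (Fin (n + 1) → ℂ), Differentiable ℂ G ∧
      Function.LeftInverse G (shiftMap (n + 1) d η) ∧
      Function.RightInverse G (shiftMap (n + 1) d η) := by
  refine ⟨fun w i => shiftMapInvCoord d η w (n - i), ?_, ?_, ?_⟩
  · have : ∀ m, Differentiable ℂ fun w : Fin (n + 1) → ℂ => shiftMapInvCoord d η w m := by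
      intro m
      induction m with
      | zero => simp only [shiftMapInvCoord]; fun_prop
      | succ m ih => simp only [shiftMapInvCoord]; fun_prop
    exact differentiable_pi.mpr fun i => this _
  · intro z
    have : ∀ m, m ≤ n → shiftMapInvCoord d η (shiftMap (n + 1) d η z) m = z ⟨n - m, by lia⟩ := by
      intro m
      induction m with
      | zero =>
        intro _
        rw [shiftMapInvCoord, shiftMap_apply_zero, inv_mul_cancel_left₀ hη]
        rfl
      | succ m ih =>
        intro hm
        have h1 : (⟨n - m, by lia⟩ : Fin (n + 1)) = Fin.succ ⟨n - (m + 1), by lia⟩ :=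
          Fin.ext (by simp; lia)
        rw [shiftMapInvCoord, ih (by lia), h1, shiftMap_apply_succ, add_sub_cancel_left,
          inv_mul_cancel_left₀ hη]
        rfl
    ext i
    beta_reduce
    rw [this _ (Nat.sub_le _ _)]
    congr 1
    exact Fin.ext (by simp; lia)
  · intro w
    ext i
    refine Fin.cases ?_ (fun j => ?_) i
    · rw [shiftMap_apply_zero]
      simp [shiftMapInvCoord, hη]
    · rw [shiftMap_apply_succ]
      beta_reduce
      have h1 : n - (j.castSucc : ℕ) = (n - (j.succ : ℕ)) + 1 := by simp; lia
      rw [h1, shiftMapInvCoord, mul_inv_cancel_left₀ hη, add_sub_cancel]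
      congr 1
      exact Fin.ext (by simp; lia)

theorem hasFDerivAt_shiftMap {k : ℕ} (d : ℕ) (η : ℂ) (z : Fin k → ℂ) :
    HasFDerivAt (shiftMap k d η) (ContinuousLinearMap.pi fun i =>
      (if i.val = 0 then 0 else ((d : ℂ) * z i ^ (d - 1)) •
        (ContinuousLinearMap.proj i : (Fin k → ℂ) →L[ℂ] ℂ)) +
      η • (ContinuousLinearMap.proj ((finRotate k).symm i) : (Fin k → ℂ) →L[ℂ] ℂ)) z := by
  rw [hasFDerivAt_pi]
  intro i
  refine HasFDerivAt.add ?_ ((hasFDerivAt_apply _ z).const_mul η)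
  split_ifs
  · exact hasFDerivAt_const _ _
  · simpa using (hasFDerivAt_apply (𝕜 := ℂ) i z).pow d

theorem norm_fderiv_shiftMap_le {k : ℕ} (d : ℕ) (η : ℂ) (z : Fin k → ℂ) :
    ‖fderiv ℂ (shiftMap k d η) z‖ ≤ d * ‖z‖ ^ (d - 1) + ‖η‖ := by
  rw [(hasFDerivAt_shiftMap d η z).fderiv]
  refine ContinuousLinearMap.opNorm_le_bound _ (by positivity) fun v => ?_
  refine (pi_norm_le_iff_of_nonneg (by positivity)).mpr fun i => ?_
  rw [add_mul]
  simp only [ContinuousLinearMap.coe_pi', add_apply,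
    smul_apply, ContinuousLinearMap.proj_apply, smul_eq_mul]
  refine (norm_add_le _ _).trans (add_le_add ?_ ?_)
  · split_ifs
    · simp only [zero_apply, norm_zero]; positivity
    · simp only [smul_apply, ContinuousLinearMap.proj_apply, smul_eq_mul,
        norm_mul, norm_pow, RCLike.norm_natCast]
      gcongr
      · exact norm_le_pi_norm z i
      · exact norm_le_pi_norm v i
  · rw [norm_mul]
    gcongr
    exact norm_le_pi_norm v _

/-- The power part contributes `1 / 2`, as `‖z i‖ ≤ 1 / 2` and `d ≥ 2`; the permuted part
contributes `1 / 4`. -/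
theorem eucNorm_shiftMap_le {k d : ℕ} (hd : 2 ≤ d) {η : ℂ} (hη : ‖η‖ ≤ 1 / 4) {z : Fin k → ℂ}
    (hz : z ∈ halfBall k) : eucNorm (shiftMap k d η z) ≤ 3 / 4 * eucNorm z := by
  have hz' : eucNorm z < 1 / 2 := hz
  have h0 : shiftMap k d η z =
      (fun i : Fin k => if i.val = 0 then 0 else z i ^ d) + η • (z ∘ (finRotate k).symm) := rfl
  have h1 : eucNorm (fun i : Fin k => if i.val = 0 then 0 else z i ^ d) ≤ 1 / 2 * eucNorm z := by
    refine eucNorm_le_of_norm_le (by norm_num) fun i => ?_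
    split_ifs
    · rw [norm_zero]; positivity
    · have h2 : ‖z i‖ ≤ 1 / 2 := ((norm_le_pi_norm z i).trans (norm_le_eucNorm z)).trans hz'.le
      have h3 : ‖z i‖ ^ d ≤ ‖z i‖ ^ 2 := pow_le_pow_of_le_one (norm_nonneg _) (by linarith) hd
      rw [norm_pow]
      nlinarith [norm_nonneg (z i)]
  have h2 : eucNorm (z ∘ (finRotate k).symm) = eucNorm z := by
    rw [← sq_eq_sq₀ (eucNorm_nonneg _) (eucNorm_nonneg _), eucNorm_sq, eucNorm_sq]
    exact Equiv.sum_comp (finRotate k).symm fun i => ‖z i‖ ^ 2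
  rw [h0]
  refine (eucNorm_add_le _ _).trans ?_
  rw [eucNorm_smul, h2]
  nlinarith [eucNorm_nonneg z]

theorem isAttracting_shiftMap {n d : ℕ} (hd : 2 ≤ d) {η : ℕ → ℂ} (hη : ∀ m, η m ≠ 0) {N : ℕ}
    (hN : ∀ m, N ≤ m → ‖η m‖ ≤ 1 / 4) :
    IsAttracting (fun m => shiftMap (n + 1) d (η m)) N where
  differentiable m := fun z => (hasFDerivAt_shiftMap d (η m) z).differentiableAt
  exists_inverse m := exists_inverse_shiftMap d (hη m)
  map_zero m := by
    ext i
    simp [shiftMap, show d ≠ 0 by lia]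
  eucNorm_le m hm z hz := eucNorm_shiftMap_le hd (hN m hm) hz

/-- By the chain rule consecutive derivatives have norm ratio at most `d ‖F(m) p‖ ^ (d - 1) + ‖η (m
+ 1)‖`, which tends to `0`. -/
theorem tendsto_fderiv_iterSeq_shiftMap {k d : ℕ} (hd : 2 ≤ d) {η : ℕ → ℂ}
    (hη : Filter.Tendsto η Filter.atTop (𝓝 0)) {p : Fin k → ℂ}
    (hp : p ∈ basin fun m => shiftMap k d (η m)) :
    Filter.Tendsto (fun m => fderiv ℂ (iterSeq (fun m => shiftMap k d (η m)) m) p)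
      Filter.atTop (𝓝 0) := by
  set F := fun m => shiftMap k d (η m)
  have hF : ∀ m, Differentiable ℂ (F m) := fun m z =>
    (hasFDerivAt_shiftMap d (η m) z).differentiableAt
  have hlim : Filter.Tendsto (fun m => (d : ℝ) * ‖iterSeq F m p‖ ^ (d - 1) + ‖η (m + 1)‖)
      Filter.atTop (𝓝 0) := by
    have h1 : Filter.Tendsto (fun m => ‖iterSeq F m p‖) Filter.atTop (𝓝 0) :=
      tendsto_zero_iff_norm_tendsto_zero.mp hp
    have h2 : Filter.Tendsto (fun m => ‖η (m + 1)‖) Filter.atTop (𝓝 0) :=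
      tendsto_zero_iff_norm_tendsto_zero.mp (hη.comp (Filter.tendsto_add_atTop_nat 1))
    simpa [show d - 1 ≠ 0 by lia] using ((h1.pow (d - 1)).const_mul (d : ℝ)).add h2
  refine (summable_of_ratio_norm_eventually_le (r := 1 / 2) (by norm_num) ?_).tendsto_atTop_zero
  filter_upwards [hlim.eventually_le_const (show (0 : ℝ) < 1 / 2 by norm_num)] with m hm
  have h1 : fderiv ℂ (iterSeq F (m + 1)) p =
      (fderiv ℂ (F (m + 1)) (iterSeq F m p)).comp (fderiv ℂ (iterSeq F m) p) :=
    fderiv_comp p (hF _ _) (differentiable_iterSeq hF m p)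
  rw [h1]
  refine (ContinuousLinearMap.opNorm_comp_le _ _).trans ?_
  gcongr
  exact (norm_fderiv_shiftMap_le d _ _).trans hm

end ShiftMap

/-! ### The plurisubharmonic function of the basin -/

section Green

open Real

variable {k d : ℕ} {a : ℝ} {η : ℕ → ℂ}

/-- The approximants `d^{-n} (log⁺ (‖F(n) z‖ / a^{d^n}) + log 2)`. -/
def greenSeq (k d : ℕ) (a : ℝ) (η : ℕ → ℂ) (n : ℕ) (z : Fin k → ℂ) : ℝ :=
  ((d : ℝ) ^ n)⁻¹ *
    (log⁺ ((a ^ d ^ n)⁻¹ * ‖iterSeq (fun m => shiftMap k d (η m)) n z‖) + log 2)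

theorem differentiable_iterSeq_shiftMap (n : ℕ) :
    Differentiable ℂ (iterSeq (fun m => shiftMap k d (η m)) n) :=
  differentiable_iterSeq (fun m z => (hasFDerivAt_shiftMap d (η m) z).differentiableAt) n

theorem continuous_greenSeq (n : ℕ) : Continuous (greenSeq k d a η n) := by
  have := (differentiable_iterSeq_shiftMap (k := k) (d := d) (η := η) n).continuous.norm
  exact ((continuous_posLog.comp (this.const_mul _)).add_const _).const_mul _

theorem greenSeq_nonneg (n : ℕ) (z : Fin k → ℂ) : 0 ≤ greenSeq k d a η n z :=
  mul_nonneg (by positivity) (add_nonneg posLog_nonneg (log_nonneg one_le_two))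

theorem greenSeq_le_circleAverage (ha : 0 < a) (n : ℕ) (z w : Fin k → ℂ) :
    greenSeq k d a η n z ≤ circleAverage (fun ζ : ℂ => greenSeq k d a η n (z + ζ • w)) 0 1 := by
  set Φ := iterSeq (fun m => shiftMap k d (η m)) n
  let s : ℂ := (((a ^ d ^ n)⁻¹ : ℝ) : ℂ)
  let g : ℂ → Fin k → ℂ := fun ζ => s • Φ (z + ζ • w)
  have hg : Differentiable ℂ g := by
    have : Differentiable ℂ fun ζ : ℂ => z + ζ • w := by fun_prop
    exact ((differentiable_iterSeq_shiftMap n).comp this).const_smul s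
  have hnorm : ∀ ζ, ‖g ζ‖ = (a ^ d ^ n)⁻¹ * ‖Φ (z + ζ • w)‖ := fun ζ => by
    rw [norm_smul, Complex.norm_real, norm_of_nonneg (by positivity)]
  have h1 := posLog_norm_le_circleAverage hg
  have h2 : (fun ζ : ℂ => greenSeq k d a η n (z + ζ • w)) =
      fun ζ => ((d : ℝ) ^ n)⁻¹ • (log⁺ ‖g ζ‖ + log 2) := by
    ext ζ
    rw [hnorm]
    rfl
  have h3 : CircleIntegrable (fun ζ => log⁺ ‖g ζ‖) 0 1 :=
    circleIntegrable_of_continuous (continuous_posLog.comp hg.continuous.norm) _ _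
  rw [h2, circleAverage_fun_smul, circleAverage_fun_add h3
    (circleIntegrable_of_continuous continuous_const _ _), circleAverage_const, smul_eq_mul]
  have h4 : greenSeq k d a η n z = ((d : ℝ) ^ n)⁻¹ * (log⁺ ‖g 0‖ + log 2) := by
    rw [hnorm, zero_smul, add_zero]
    rfl
  rw [h4]
  gcongr

/-- One step takes the normalized norm `x` to at most `2 * max 1 x ^ d`. The summand `log 2` in
`greenSeq` absorbs this factor `2`, since `2 log 2 ≤ d log 2`. -/
theorem antitone_greenSeq (hd : 2 ≤ d) (ha : 0 < a) (ha1 : a < 1)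
    (hη : ∀ n, ‖η n‖ ≤ a ^ d ^ n) (z : Fin k → ℂ) : Antitone fun n => greenSeq k d a η n z := by
  refine antitone_nat_of_succ_le fun n => ?_
  set Φ := iterSeq (fun m => shiftMap k d (η m))
  set s := a ^ d ^ n
  have hs : 0 < s := by positivity
  have hs1 : s ≤ 1 := pow_le_one₀ ha.le ha1.le
  have hss : a ^ d ^ (n + 1) = s ^ d := by rw [pow_succ, pow_mul]
  set x := s⁻¹ * ‖Φ n z‖
  have hx : 0 ≤ x := by positivity
  have hΦ : ‖Φ n z‖ = s * x := by simp only [x]; field_simp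
  set y := max 1 x
  have hy1 : 1 ≤ y := le_max_left _ _
  have hyd : y ≤ y ^ d := le_self_pow₀ hy1 (by lia)
  have hstep : (s ^ d)⁻¹ * ‖Φ (n + 1) z‖ ≤ 2 * y ^ d := by
    rw [inv_mul_le_iff₀ (by positivity)]
    have h1 : ‖Φ (n + 1) z‖ ≤ ‖Φ n z‖ ^ d + ‖η (n + 1)‖ * ‖Φ n z‖ := norm_shiftMap_le _ _
    have h2 : ‖η (n + 1)‖ ≤ s ^ d := hss ▸ hη (n + 1)
    calc ‖Φ (n + 1) z‖ ≤ (s * x) ^ d + s ^ d * (s * x) := by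
          rw [hΦ] at h1
          exact h1.trans (by gcongr)
      _ ≤ s ^ d * y ^ d + s ^ d * y ^ d := by
          rw [mul_pow]
          gcongr
          · exact le_max_right _ _
          · exact (mul_le_of_le_one_left hx hs1).trans ((le_max_right _ _).trans hyd)
      _ = s ^ d * (2 * y ^ d) := by ring
  have hlog : log⁺ ((s ^ d)⁻¹ * ‖Φ (n + 1) z‖) ≤ log 2 + d * log⁺ x := by
    refine (posLog_le_posLog (by positivity) hstep).trans ?_
    rw [posLog_eq_log, log_mul two_ne_zero (by positivity), log_pow, posLog_eq_log_max_one hx]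
    rw [abs_of_nonneg (by positivity)]
    linarith
  have hd0 : (0 : ℝ) < d := by exact_mod_cast (by lia : 0 < d)
  have hd2 : (2 : ℝ) ≤ d := by exact_mod_cast hd
  have hl2 : 0 < log 2 := log_pos one_lt_two
  change ((d : ℝ) ^ (n + 1))⁻¹ * (log⁺ ((a ^ d ^ (n + 1))⁻¹ * ‖Φ (n + 1) z‖) + log 2) ≤
    ((d : ℝ) ^ n)⁻¹ * (log⁺ x + log 2)
  rw [hss, pow_succ (d : ℝ) n, mul_inv, mul_assoc]
  gcongr
  rw [inv_mul_le_iff₀ hd0]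
  nlinarith

theorem bddBelow_greenSeq (z : Fin k → ℂ) : BddBelow (Set.range fun n => greenSeq k d a η n z) :=
  ⟨0, by rintro _ ⟨n, rfl⟩; exact greenSeq_nonneg n z⟩

theorem tendsto_natCast_pow_atTop (hd : 2 ≤ d) :
    Filter.Tendsto (fun n => (d : ℝ) ^ n) Filter.atTop Filter.atTop :=
  tendsto_pow_atTop_atTop_of_one_lt (by exact_mod_cast (by lia : 1 < d))

theorem tendsto_pow_pow_atTop_nhds_zero (hd : 2 ≤ d) (ha : 0 < a) (ha1 : a < 1) :
    Filter.Tendsto (fun m : ℕ => a ^ d ^ m) Filter.atTop (𝓝 0) :=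
  (tendsto_pow_atTop_nhds_zero_of_lt_one ha.le ha1).comp
    (pow_right_strictMono₀ (by lia)).tendsto_atTop

theorem basin_eq_iInf_greenSeq_lt (hd : 2 ≤ d) (ha : 0 < a) (ha1 : a < 1)
    (hη : ∀ n, ‖η n‖ ≤ a ^ d ^ n) :
    basin (fun m => shiftMap k d (η m)) = {z | log a + ⨅ n, greenSeq k d a η n z < 0} := by
  ext z
  set Φ := iterSeq (fun m => shiftMap k d (η m))
  have hla : log a < 0 := log_neg ha ha1
  have hdpos : ∀ n, (0 : ℝ) < (d : ℝ) ^ n := fun n => by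
    have : (0 : ℝ) < d := by exact_mod_cast (by lia : 0 < d)
    positivity
  have hl2 : 0 < log 2 := log_pos one_lt_two
  have hlogs : ∀ n, log (a ^ d ^ n) = (d : ℝ) ^ n * log a := fun n => by
    rw [log_pow, Nat.cast_pow]
  constructor
  · intro hz
    have h1 : Filter.Tendsto (fun n => ‖Φ n z‖) Filter.atTop (𝓝 0) :=
      tendsto_zero_iff_norm_tendsto_zero.mp hz
    -- The bound `1 / 2` cancels the summand `log 2`; the bound on `d ^ n` covers the case where
    -- `log⁺` vanishes.
    obtain ⟨n, hn, hn2⟩ := ((h1.eventually_lt_const (show (0 : ℝ) < 1 / 2 by norm_num)).and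
      ((tendsto_natCast_pow_atTop hd).eventually_gt_atTop (log 2 / -log a))).exists
    rw [div_lt_iff₀ (by linarith)] at hn2
    change log a + ⨅ n, greenSeq k d a η n z < 0
    refine lt_of_le_of_lt (add_le_add le_rfl (ciInf_le (bddBelow_greenSeq z) n)) ?_
    suffices h : greenSeq k d a η n z < -log a by linarith
    change ((d : ℝ) ^ n)⁻¹ * (log⁺ ((a ^ d ^ n)⁻¹ * ‖Φ n z‖) + log 2) < -log a
    rw [inv_mul_lt_iff₀ (hdpos n), posLog_apply, max_add, max_lt_iff, zero_add]
    refine ⟨hn2, ?_⟩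
    rcases (norm_nonneg (Φ n z)).eq_or_lt with h0 | h0
    · rw [← h0, mul_zero, log_zero, zero_add]
      exact hn2
    · rw [log_mul (by positivity) h0.ne', log_inv, hlogs]
      have h3 : log ‖Φ n z‖ < log (1 / 2) := log_lt_log h0 hn
      rw [one_div, log_inv] at h3
      linarith
  · intro hz
    have hz' : ⨅ n, greenSeq k d a η n z < -log a := by
      have : log a + ⨅ n, greenSeq k d a η n z < 0 := hz
      linarith
    obtain ⟨m, hm⟩ := exists_lt_of_ciInf_lt hz'
    set b := greenSeq k d a η m z
    -- Since `b + log a < 0`, this bound decays to `0`.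
    have hbound : ∀ n, m ≤ n → ‖Φ n z‖ ≤ exp ((d : ℝ) ^ n * (b + log a)) := by
      intro n hn
      have h1 : greenSeq k d a η n z ≤ b := antitone_greenSeq hd ha ha1 hη z hn
      change ((d : ℝ) ^ n)⁻¹ * (log⁺ ((a ^ d ^ n)⁻¹ * ‖Φ n z‖) + log 2) ≤ b at h1
      rw [inv_mul_le_iff₀ (hdpos n)] at h1
      rcases (norm_nonneg (Φ n z)).eq_or_lt with h0 | h0
      · rw [← h0]; positivity
      · have h2 : log ((a ^ d ^ n)⁻¹ * ‖Φ n z‖) ≤ log⁺ ((a ^ d ^ n)⁻¹ * ‖Φ n z‖) :=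
          le_max_right _ _
        rw [log_mul (by positivity) h0.ne', log_inv, hlogs] at h2
        rw [← log_le_iff_le_exp h0]
        linarith
    refine tendsto_zero_iff_norm_tendsto_zero.mpr ?_
    refine squeeze_zero' (Filter.Eventually.of_forall fun _ => norm_nonneg _)
      (Filter.eventually_atTop.mpr ⟨m, hbound⟩) ?_
    exact tendsto_exp_atBot.comp
      ((tendsto_natCast_pow_atTop hd).atTop_mul_const_of_neg (by linarith))

theorem iInf_greenSeq_zero (hd : 2 ≤ d) : ⨅ n, greenSeq k d a η n 0 = 0 := by
  have h0 : ∀ n, greenSeq k d a η n (0 : Fin k → ℂ) = ((d : ℝ) ^ n)⁻¹ * log 2 := fun n => by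
    rw [greenSeq, iterSeq_apply_zero fun m => ?_]
    · simp
    · ext i
      simp [shiftMap, show d ≠ 0 by lia]
  refine le_antisymm ?_ (le_ciInf fun n => greenSeq_nonneg n _)
  have hlim : Filter.Tendsto (fun n => ((d : ℝ) ^ n)⁻¹ * log 2) Filter.atTop (𝓝 0) := by
    simpa using (tendsto_natCast_pow_atTop hd).inv_tendsto_atTop.mul_const (log 2)
  exact ge_of_tendsto hlim (Filter.Eventually.of_forall fun n =>
    (ciInf_le (bddBelow_greenSeq 0) n).trans (h0 n).le)

/-- The point is chosen so that its orbit enters the half ball yet shrinks more slowly than `a ^ d ^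
n`: from time `m` on its second coordinate is at least `2 * (2 * s) ^ d ^ j`, which beats `s ^ d ^
j` by `2 ^ d ^ j`. -/
theorem exists_mem_basin_iInf_greenSeq_pos {n : ℕ} (hd : 2 ≤ d) (ha : 0 < a) (ha1 : a < 1)
    (hη : ∀ m, ‖η m‖ ≤ a ^ d ^ m) {N : ℕ}
    (hF : IsAttracting (fun m => shiftMap (n + 2) d (η m)) N) :
    ∃ z ∈ basin (fun m => shiftMap (n + 2) d (η m)), 0 < ⨅ m, greenSeq (n + 2) d a η m z := by
  set Φ := iterSeq (fun m => shiftMap (n + 2) d (η m))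
  have hs0 := tendsto_pow_pow_atTop_nhds_zero hd ha ha1
  obtain ⟨m, hm, hNm⟩ := ((hs0.eventually_lt_const (show (0 : ℝ) < 1 / 8 by norm_num)).and
    (Filter.eventually_ge_atTop N)).exists
  set s := a ^ d ^ m
  have hs : 0 < s := by positivity
  obtain ⟨H, -, -, hr⟩ := exists_inverse_iterSeq hF.exists_inverse m
  -- `s < 1 / 8` puts `4 * s` below the radius `1 / 2`.
  set w : Fin (n + 2) → ℂ := ((4 * s : ℝ) : ℂ) • Pi.single 1 1
  have hw1 : ‖w 1‖ = 4 * s := by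
    simp only [w, Pi.smul_apply, Pi.single_eq_same, smul_eq_mul, mul_one]
    rw [Complex.norm_real, norm_of_nonneg (by positivity)]
  have hwB : w ∈ halfBall (n + 2) := by
    have h1 : eucNorm (Pi.single 1 1 : Fin (n + 2) → ℂ) = 1 := by
      rw [← sq_eq_sq₀ (eucNorm_nonneg _) zero_le_one, eucNorm_sq, Finset.sum_eq_single 1]
      · simp
      · intro j _ hj
        simp [hj]
      · simp
    change eucNorm w < 1 / 2
    rw [eucNorm_smul, h1, Complex.norm_real, norm_of_nonneg (by positivity)]
    linarith
  have hz : Φ m (H w) = w := hr w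
  have hzB : Φ m (H w) ∈ halfBall (n + 2) := by rwa [hz]
  have hone : (1 : Fin (n + 2)).val ≠ 0 := by simp
  have hlow : ∀ j, 2 * (2 * s) ^ d ^ j ≤ ‖Φ (m + j) (H w) 1‖ := by
    intro j
    induction j with
    | zero =>
      rw [add_zero, hz, hw1, pow_zero, pow_one]
      linarith
    | succ j ih =>
      have h1 : ‖Φ (m + j) (H w)‖ ≤ 1 := by
        have : eucNorm (Φ (m + j) (H w)) < 1 / 2 := (hF.eucNorm_iterSeq_le hNm hzB j).1
        linarith [norm_le_eucNorm (Φ (m + j) (H w))]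
      have h2 : ‖η (m + (j + 1))‖ ≤ (2 * s) ^ d ^ (j + 1) := by
        refine (hη _).trans ?_
        rw [pow_add, pow_mul]
        gcongr
        linarith
      have h3 : ‖Φ (m + j) (H w) 1‖ ^ d - ‖η (m + (j + 1))‖ * ‖Φ (m + j) (H w)‖ ≤
          ‖Φ (m + (j + 1)) (H w) 1‖ := norm_shiftMap_apply_ge _ _ _ _ hone
      -- The prefactor `2` becomes `2 ^ d ≥ 4`, which leaves room for the perturbation, itself at
      -- most `(2 * s) ^ d ^ (j + 1)`.
      have h4 : 4 * (2 * s) ^ d ^ (j + 1) ≤ ‖Φ (m + j) (H w) 1‖ ^ d := by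
        calc 4 * (2 * s) ^ d ^ (j + 1) ≤ 2 ^ d * (2 * s) ^ d ^ (j + 1) := by
              gcongr
              calc (4 : ℝ) = 2 ^ 2 := by norm_num
                _ ≤ 2 ^ d := pow_le_pow_right₀ one_le_two hd
          _ = (2 * (2 * s) ^ d ^ j) ^ d := by
            rw [pow_succ d j, pow_mul, mul_pow 2 ((2 * s) ^ d ^ j)]
          _ ≤ _ := by gcongr
      have h5 := mul_le_of_le_one_right (norm_nonneg (η (m + (j + 1)))) h1
      have h6 : 0 < (2 * s) ^ d ^ (j + 1) := by positivity
      linarith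
  refine ⟨H w, hF.mem_basin hNm hzB, ?_⟩
  have hd0 : (0 : ℝ) < d := by exact_mod_cast (by lia : 0 < d)
  have hl2 : 0 < log 2 := log_pos one_lt_two
  refine lt_of_lt_of_le (show 0 < ((d : ℝ) ^ m)⁻¹ * log 2 by positivity) (le_ciInf fun l => ?_)
  refine le_trans ?_ (antitone_greenSeq hd ha ha1 hη (H w) (Nat.le_add_left l m))
  change _ ≤ ((d : ℝ) ^ (m + l))⁻¹ * (log⁺ ((a ^ d ^ (m + l))⁻¹ * ‖Φ (m + l) (H w)‖) + log 2)
  have hx : (2 : ℝ) ^ d ^ l ≤ (a ^ d ^ (m + l))⁻¹ * ‖Φ (m + l) (H w)‖ := by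
    rw [le_inv_mul_iff₀ (by positivity), pow_add, pow_mul]
    calc s ^ d ^ l * 2 ^ d ^ l ≤ 2 * (2 * s) ^ d ^ l := by
          rw [← mul_pow, mul_comm s 2]
          linarith [show 0 < (2 * s) ^ d ^ l by positivity]
      _ ≤ _ := (hlow l).trans (norm_le_pi_norm _ _)
  have hp : (d : ℝ) ^ l * log 2 ≤ log⁺ ((a ^ d ^ (m + l))⁻¹ * ‖Φ (m + l) (H w)‖) := by
    refine le_trans ?_ (le_max_right _ _)
    refine le_trans ?_ (log_le_log (by positivity) hx)
    rw [log_pow, Nat.cast_pow]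
  rw [le_inv_mul_iff₀ (by positivity), pow_add]
  calc (d : ℝ) ^ m * d ^ l * (((d : ℝ) ^ m)⁻¹ * log 2) = d ^ l * log 2 := by field_simp
    _ ≤ _ := by linarith

end Green

/-! ### Assembly of the basin's properties and the main theorem -/

theorem isShortCk_basin_shiftMap {n d : ℕ} {a : ℝ} {η : ℕ → ℂ} (hd : 2 ≤ d) (ha : 0 < a)
    (ha1 : a < 1) (hη0 : ∀ m, η m ≠ 0) (hη : ∀ m, ‖η m‖ ≤ a ^ d ^ m) :
    IsShortCk (basin fun m => shiftMap (n + 2) d (η m)) := by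
  have hlim : Filter.Tendsto (fun m => ‖η m‖) Filter.atTop (𝓝 0) :=
    squeeze_zero (fun _ => norm_nonneg _) hη (tendsto_pow_pow_atTop_nhds_zero hd ha ha1)
  obtain ⟨N, hN⟩ := Filter.eventually_atTop.mp
    (hlim.eventually_le_const (show (0 : ℝ) < 1 / 4 by norm_num))
  have hF : IsAttracting (fun m => shiftMap (n + 2) d (η m)) N := isAttracting_shiftMap hd hη0 hN
  refine ⟨hF.isOpen_basin, hF.isConnected_basin, ?_, ?_, ?_⟩
  · exact ⟨fun j => iterSeq _ (N + j) ⁻¹' halfBall (n + 2), fun j => ⟨hF.isOpen_preimage _,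
      hF.preimage_halfBall_subset j, hF.biholomorphic_preimage _⟩, hF.basin_eq_iUnion⟩
  · exact fun p hp ξ => hF.kobayashiMetric_basin_eq_zero hp
      (tendsto_fderiv_iterSeq_shiftMap hd (tendsto_zero_iff_norm_tendsto_zero.mpr hlim) hp) ξ
  · obtain ⟨q, hq, hqpos⟩ := exists_mem_basin_iInf_greenSeq_pos hd ha ha1 hη hF
    refine ⟨fun z => Real.log a + ⨅ m, greenSeq (n + 2) d a η m z,
      isPlurisubharmonic_iInf continuous_greenSeq greenSeq_nonneg (antitone_greenSeq hd ha ha1 hη)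
        (greenSeq_le_circleAverage ha) _, ?_, basin_eq_iInf_greenSeq_lt hd ha ha1 hη,
      0, zero_mem_basin hF.map_zero, q, hq, ?_⟩
    · refine ⟨Real.log a, ?_⟩
      rintro _ ⟨z, rfl⟩
      exact le_add_of_nonneg_right (le_ciInf fun m => greenSeq_nonneg m z)
    · beta_reduce
      rw [iInf_greenSeq_zero hd]
      linarith

end ShortCk

end

theorem proposition4p1 (k : ℕ) (hk : 3 ≤ k) (V : Set (Fin k → ℂ))
    (hV : ShortCk.IsAlgebraicOfCodim V 2) :
    (∃ Ω : Set (Fin k → ℂ), ShortCk.IsShortCk Ω ∧ Disjoint Ω V) ∧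
    ∀ (d : ℕ) (a : ℝ) (η : ℕ → ℂ) (R : ℝ), 2 ≤ d → 0 < a → a < 1 →
      (∀ n, η n ≠ 0 ∧ ‖η n‖ ≤ a ^ d ^ n) → 1 + a < R →
      ∃ L : (Fin k → ℂ) ≃ₗ[ℂ] (Fin k → ℂ),
        Set.MapsTo (fun z => ShortCk.translate k R (L z)) V (ShortCk.Vplus k R) ∧
        ShortCk.IsShortCk ((fun z => ShortCk.translate k R (L z)) ⁻¹'
          ShortCk.basin (fun n => ShortCk.shiftMap k d (η n))) ∧
        Disjoint ((fun z => ShortCk.translate k R (L z)) ⁻¹'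
          ShortCk.basin (fun n => ShortCk.shiftMap k d (η n))) V := by
  obtain ⟨n, rfl⟩ : ∃ n, k = n + 2 := ⟨k - 2, by lia⟩
  -- `L` depends on `V` alone and serves all `d`, `a`, `η` and `R`.
  obtain ⟨L, hL⟩ := ShortCk.exists_linearEquiv_norm_le V (by rw [hV.2]; rfl)
  have main : ∀ (d : ℕ) (a : ℝ) (η : ℕ → ℂ) (R : ℝ), 2 ≤ d → 0 < a → a < 1 →
      (∀ n, η n ≠ 0 ∧ ‖η n‖ ≤ a ^ d ^ n) → 1 + a < R →
      Set.MapsTo (fun z => ShortCk.translate (n + 2) R (L z)) V (ShortCk.Vplus (n + 2) R) ∧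
      ShortCk.IsShortCk ((fun z => ShortCk.translate (n + 2) R (L z)) ⁻¹'
        ShortCk.basin (fun m => ShortCk.shiftMap (n + 2) d (η m))) ∧
      Disjoint ((fun z => ShortCk.translate (n + 2) R (L z)) ⁻¹'
        ShortCk.basin (fun m => ShortCk.shiftMap (n + 2) d (η m))) V := by
    intro d a η R hd ha ha1 hη hR
    have hmaps : Set.MapsTo (fun z => ShortCk.translate (n + 2) R (L z)) V
        (ShortCk.Vplus (n + 2) R) := fun z hz =>
      ShortCk.translate_mem_Vplus (by linarith) _ (hL z hz).1 (hL z hz).2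
    refine ⟨hmaps, ?_, ?_⟩
    · simp only [ShortCk.translate_eq_add _ _ (L _)]
      exact (ShortCk.isShortCk_basin_shiftMap hd ha ha1 (fun m => (hη m).1)
        fun m => (hη m).2).preimage_affine L _
    · refine Set.disjoint_left.mpr fun z hz hzV => ?_
      refine Set.disjoint_left.mp (ShortCk.disjoint_basin_Vplus hd ha ha1 (fun m => ?_) hR) hz
        (hmaps hzV)
      exact (hη m).2.trans (pow_le_of_le_one ha.le ha1.le (pow_pos (by lia) m).ne')
  refine ⟨?_, fun d a η R hd ha ha1 hη hR => ⟨L, main d a η R hd ha ha1 hη hR⟩⟩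
  obtain ⟨-, h1, h2⟩ := main 2 (1 / 2) (fun m => (1 / 2) ^ 2 ^ m) 2 le_rfl (by norm_num)
    (by norm_num) (fun m => ⟨pow_ne_zero _ (by norm_num), by simp⟩) (by norm_num)
  exact ⟨_, h1, h2⟩
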